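/- Let $(B,\omega)$ be a closed connected symplectic manifold, let $S^1=\mathbb{R}/2\pi\mathbb{Z}$, and let $\pi\colon M\to B$ be a Boothby–Wang bundle over $(B,\omega)$, that is, a smooth principal $S^1$-bundle with a connection $1$-form $\alpha$ (an $S^1$-invariant $1$-form taking the value $1$ on the generator of the principal action) such that $\mathrm{d}\alpha=\pi^*\omega$; such a bundle exists precisely when $[\omega/2\pi]$ is an integral cohomology class. Let an $S^1$-action on $B$ be Hamiltonian, that is, generated by a vector field $X$ with $\omega(X,\cdot)=-\mathrm{d}H$ for a smooth function $H\colon B\to\mathbb{R}$. Then the Reeb vector field $R$ of $\alpha$ (defined by $\alpha(R)=1$, $\mathrm{d}\alpha(R,\cdot)=0$) and the horizontal lift $X_{\mathrm h}$ of $X$ (defined by $\alpha(X_{\mathrm h})=0$, $T\pi(X_{\mathrm h})=X$) exist, and: (i) $X$ has a zero, and for every zero $p_0$ of $X$ one can add a constant to $H$ so that $H>0$ and $H(p_0)$ is a natural number. (ii) Suppose that a constant has been added to $H$ so that $H(p_0)\in\mathbb{Z}$ for some zero $p_0$ of $X$, and let $\tilde H:=H\circ\pi$. Then $H(p)\in\mathbb{Z}$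 for every zero $p$ of $X$, and the vector field $\tilde X:=\tilde H R+X_{\mathrm h}$ generates a smooth $S^1$-action on $M$ that lifts the given action on $B$ (i.e. $\pi$ is equivariant) and preserves $\alpha$. This action is Hamiltonian with respect to $\alpha$: $\tilde X$ is the contact Hamiltonian vector field of $\tilde H$, that is, $\alpha(\tilde X)=\tilde H$ and $\mathrm{d}\alpha(\tilde X,\cdot)=\mathrm{d}\tilde H(R)\,\alpha-\mathrm{d}\tilde H$. In particular, every Hamiltonian $S^1$-action on $(B,\omega)$ lifts to a Hamiltonian $S^1$-action on $(M,\alpha)$. -/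

import Mathlib

open scoped Manifold ContDiff

noncomputable section

namespace BoothbyWang

/-! ### Differential forms on manifolds without boundary -/

/-- A (not necessarily smooth) differential `k`-form on a manifold `N` modelled on `E`. -/
abbrev DiffForm (E : Type*) [NormedAddCommGroup E] [NormedSpace ℝ E]
    (N : Type*) [TopologicalSpace N] [ChartedSpace E N] (k : ℕ) : Type _ :=
  ∀ x : N, TangentSpace 𝓘(ℝ, E) x [⋀^Fin k]→L[ℝ] ℝ

namespace DiffForm

variable {E : Type*} [NormedAddCommGroup E] [NormedSpace ℝ E]
  {N : Type*} [TopologicalSpace N] [ChartedSpace E N]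
  {E' : Type*} [NormedAddCommGroup E'] [NormedSpace ℝ E']
  {N' : Type*} [TopologicalSpace N'] [ChartedSpace E' N'] {k : ℕ}

/-- The pullback `f^* η` of a form under a (differentiable) map `f`. -/
def pullback (f : N → N') (η : DiffForm E' N' k) : DiffForm E N k := fun x =>
  (η (f x)).compContinuousLinearMap (mfderiv 𝓘(ℝ, E) 𝓘(ℝ, E') f x)

/-- The expression of `η` in the preferred chart at `x₀`: its pullback under the inverse of that
chart, relevant on the (open) target of the chart. -/
def inChart (η : DiffForm E N k) (x₀ : N) : E → E [⋀^Fin k]→L[ℝ] ℝ := fun y =>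
  (η ((extChartAt 𝓘(ℝ, E) x₀).symm y)).compContinuousLinearMap
    (mfderiv 𝓘(ℝ, E) 𝓘(ℝ, E) (extChartAt 𝓘(ℝ, E) x₀).symm y)

/-- A form is smooth if all its chart expressions are. -/
def IsSmooth (η : DiffForm E N k) : Prop :=
  ∀ x₀ : N, ContDiffOn ℝ ∞ (η.inChart x₀) (extChartAt 𝓘(ℝ, E) x₀).target

/-- The exterior derivative, computed at `x` in the preferred chart at `x`. -/
def d (η : DiffForm E N k) : DiffForm E N (k + 1) := fun x =>
  (extDeriv (η.inChart x) (extChartAt 𝓘(ℝ, E) x x)).compContinuousLinearMap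
    (mfderiv 𝓘(ℝ, E) 𝓘(ℝ, E) (extChartAt 𝓘(ℝ, E) x) x)

end DiffForm

/-! ### Circle actions -/

/-- A smooth action of the circle on a manifold `N`. The identification `S¹ = ℝ / 2πℤ` is given by
`Circle.exp : t ↦ e^{it}`. -/
structure SmoothCircleAction (E : Type*) [NormedAddCommGroup E] [NormedSpace ℝ E]
    (N : Type*) [TopologicalSpace N] [ChartedSpace E N] extends MulAction Circle N where
  contMDiffSMul : ContMDiffSMul (𝓡 1) 𝓘(ℝ, E) ∞ Circle N

/-- The diffeomorphism of `N` by which `g` acts. -/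
def SmoothCircleAction.act {E : Type*} [NormedAddCommGroup E] [NormedSpace ℝ E]
    {N : Type*} [TopologicalSpace N] [ChartedSpace E N] (A : SmoothCircleAction E N) (g : Circle) :
    N → N := fun x => A.smul g x

/-- The vector field generating a circle action: its value at `x` is the velocity at `t = 0` of
`t ↦ e^{it} · x`. -/
def SmoothCircleAction.generator {E : Type*} [NormedAddCommGroup E] [NormedSpace ℝ E]
    {N : Type*} [TopologicalSpace N] [ChartedSpace E N] (A : SmoothCircleAction E N) (x : N) :
    TangentSpace 𝓘(ℝ, E) x :=
  mfderiv 𝓘(ℝ, ℝ) 𝓘(ℝ, E) (fun t : ℝ => A.act (Circle.exp t) x) 0 (1 : ℝ)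

section Symplectic

variable {E : Type*} [NormedAddCommGroup E] [NormedSpace ℝ E]
  {B : Type*} [TopologicalSpace B] [ChartedSpace E B]

/-- A symplectic form: a smooth closed non-degenerate 2-form. -/
structure IsSymplectic (Ω : DiffForm E B 2) : Prop where
  smooth : Ω.IsSmooth
  closed : ∀ b, Ω.d b = 0
  nondegenerate : ∀ (b : B) (v : TangentSpace 𝓘(ℝ, E) b),
    (∀ w : TangentSpace 𝓘(ℝ, E) b, Ω b ![v, w] = 0) → v = 0

/-- The circle action `A` is Hamiltonian with Hamiltonian function `H`: its generator `X` satisfies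
`Ω(X, ·) = -dH`. -/
structure IsHamiltonianAction (Ω : DiffForm E B 2) (A : SmoothCircleAction E B) (H : B → ℝ) :
    Prop where
  smooth : ContMDiff 𝓘(ℝ, E) 𝓘(ℝ, ℝ) ∞ H
  hamiltonian : ∀ (b : B) (v : TangentSpace 𝓘(ℝ, E) b),
    Ω b ![A.generator b, v] = -mvfderiv 𝓘(ℝ, E) H b v

end Symplectic

section Bundles

variable {E : Type*} [NormedAddCommGroup E] [NormedSpace ℝ E]
  {B : Type*} [TopologicalSpace B] [ChartedSpace E B]
  {E' : Type*} [NormedAddCommGroup E'] [NormedSpace ℝ E']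
  {M : Type*} [TopologicalSpace M] [ChartedSpace E' M]

/-- `π : M → B`, together with the circle action `P` on `M`, is a smooth principal `S¹`-bundle:
it is invariant and admits smooth equivariant local trivialisations `π⁻¹(U) ≅ U × S¹`. -/
structure IsPrincipalCircleBundle (P : SmoothCircleAction E' M) (π : M → B) : Prop where
  smooth : ContMDiff 𝓘(ℝ, E') 𝓘(ℝ, E) ∞ π
  invariant : ∀ (g : Circle) (x : M), π (P.act g x) = π x
  locally_trivial : ∀ b : B, ∃ e : Bundle.Trivialization Circle π, b ∈ e.baseSet ∧
    ContMDiffOn 𝓘(ℝ, E') (𝓘(ℝ, E).prod (𝓡 1)) ∞ e e.source ∧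
    ContMDiffOn (𝓘(ℝ, E).prod (𝓡 1)) 𝓘(ℝ, E') ∞ e.toOpenPartialHomeomorph.symm e.target ∧
    ∀ (g : Circle), ∀ x ∈ e.source, e (P.act g x) = (π x, g * (e x).2)

/-- `α` is a connection 1-form for the principal circle action `P` (the Lie algebra of
`S¹ = ℝ / 2πℤ` being identified with `ℝ`). -/
structure IsConnectionForm (P : SmoothCircleAction E' M) (α : DiffForm E' M 1) : Prop where
  smooth : α.IsSmooth
  invariant : ∀ g : Circle, α.pullback (P.act g) = α
  normalized : ∀ x : M, α x ![P.generator x] = 1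

/-- `(M, α)` with projection `π` and principal action `P` is a Boothby–Wang bundle over `(B, Ω)`:
a principal circle bundle with connection form `α` of curvature `Ω`, that is, `dα = π^* Ω`. -/
structure IsBoothbyWangBundle (Ω : DiffForm E B 2) (P : SmoothCircleAction E' M) (π : M → B)
    (α : DiffForm E' M 1) : Prop where
  principal : IsPrincipalCircleBundle (E := E) P π
  connection : IsConnectionForm P α
  curvature : α.d = Ω.pullback π

/-- `R` is the Reeb vector field of `α`: `α(R) = 1` and `dα(R, ·) = 0`. -/
def IsReebField (α : DiffForm E' M 1) (R : ∀ x : M, TangentSpace 𝓘(ℝ, E') x) : Prop :=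
  ∀ x : M, α x ![R x] = 1 ∧ ∀ v : TangentSpace 𝓘(ℝ, E') x, α.d x ![R x, v] = 0

/-- `Y` is the horizontal lift of the vector field `X`: `α(Y) = 0` and `Tπ(Y) = X`. -/
def IsHorizontalLift (π : M → B) (α : DiffForm E' M 1) (X : ∀ b : B, TangentSpace 𝓘(ℝ, E) b)
    (Y : ∀ x : M, TangentSpace 𝓘(ℝ, E') x) : Prop :=
  ∀ x : M, α x ![Y x] = 0 ∧ mfderiv 𝓘(ℝ, E') 𝓘(ℝ, E) π x (Y x) = X (π x)

/-- `Y` is the contact Hamiltonian vector field of the function `F` with respect to the contact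
form `α` with Reeb vector field `R`: `α(Y) = F` and `dα(Y, ·) = dF(R) α - dF`. -/
def IsContactHamiltonianField (α : DiffForm E' M 1) (R : ∀ x : M, TangentSpace 𝓘(ℝ, E') x)
    (F : M → ℝ) (Y : ∀ x : M, TangentSpace 𝓘(ℝ, E') x) : Prop :=
  ∀ x : M, α x ![Y x] = F x ∧ ∀ v : TangentSpace 𝓘(ℝ, E') x,
    α.d x ![Y x, v] =
      mvfderiv 𝓘(ℝ, E') F x (R x) * α x ![v] - mvfderiv 𝓘(ℝ, E') F x v

end Bundles

end BoothbyWang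

end

/-! Write V for the field (H∘π + c)R + X_h, where R is the generator of the principal action. Then
α(V) = H∘π + c and V projects to X, so dα(V, ·) = π^*(ω(X, ·)) = -d(H∘π), and Cartan's formula gives
L_V α = 0. Hence the flow of V covers the action on B, preserves α and commutes with the principal
action.

The time-2π map T therefore covers the identity of B and preserves α. Locally T rotates the fibres
by an angle κ with T^*α = α + dκ, so κ is locally constant; as B is connected, T is the identity as
soon as it has a fixed point (`IsConnectionForm.gauge_eq_self`). Over a zero p of X the field V
equals (H(p) + c)R, and T rotates that fibre by 2π(H(p) + c). Integrality at one zero thus gives T =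
id, which makes the flow a circle action and forces integrality at every other zero. Zeros exist
because dH vanishes at a minimum of H and ω is non-degenerate.

X_h is chosen pointwise, so V is not known to be smooth at the outset. `hasLocalFlowAt_lift` writes
its local flow in closed form from a local section, the action on B and one integration in t;
smoothness of V and, M being compact, a smooth global flow (`exists_global_flow`) follow. The lift
itself is assembled in `IsBoothbyWangBundle.exists_lift`. -/

noncomputable section

namespace BoothbyWang

open Set Filter Topology

/-! ### Forms pulled back to a vector space, and naturality of `d`. -/

namespace DiffForm

variable {E : Type*} [NormedAddCommGroup E] [NormedSpace ℝ E]
  {N : Type*} [TopologicalSpace N] [ChartedSpace E N]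
  {Y : Type*} [NormedAddCommGroup Y] [NormedSpace ℝ Y] {k : ℕ}

/-- The pullback of a form under a map defined on a normed space. -/
def pullbackVec (η : DiffForm E N k) (σ : Y → N) : Y → Y [⋀^Fin k]→L[ℝ] ℝ := fun y =>
  (η (σ y)).compContinuousLinearMap (mfderiv 𝓘(ℝ, Y) 𝓘(ℝ, E) σ y)

theorem pullbackVec_apply (η : DiffForm E N k) (σ : Y → N) (y : Y) (v : Fin k → Y) :
    η.pullbackVec σ y v = η (σ y) (fun i => mfderiv 𝓘(ℝ, Y) 𝓘(ℝ, E) σ y (v i)) := rfl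

/-- Near `y` the map factors through the one chart at `σ y`, which is the chart used by `d` at `σ
y`. This turns statements about forms on the manifold into statements about `inChart` and ordinary
derivatives. -/
theorem pullbackVec_eventuallyEq [IsManifold 𝓘(ℝ, E) ∞ N] (η : DiffForm E N k) {σ : Y → N} {y : Y}
    (hσ : ContMDiffAt 𝓘(ℝ, Y) 𝓘(ℝ, E) ∞ σ y) :
    η.pullbackVec σ =ᶠ[𝓝 y] fun z =>
      (η.inChart (σ y) (extChartAt 𝓘(ℝ, E) (σ y) (σ z))).compContinuousLinearMap
        (fderiv ℝ (fun z => extChartAt 𝓘(ℝ, E) (σ y) (σ z)) z) := by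
  have h1 : ∀ᶠ z in 𝓝 y, σ z ∈ (extChartAt 𝓘(ℝ, E) (σ y)).source :=
    hσ.continuousAt.preimage_mem_nhds (extChartAt_source_mem_nhds _)
  have h2 : ∀ᶠ z in 𝓝 y, ContMDiffAt 𝓘(ℝ, Y) 𝓘(ℝ, E) 1 σ z :=
    (contMDiffAt_iff_contMDiffAt_nhds (by simp)).1 (hσ.of_le (by simp))
  filter_upwards [h1, h1.eventually_nhds, h2] with z hz hz' hσz
  set φ := extChartAt 𝓘(ℝ, E) (σ y)
  have hφ : MDifferentiableAt 𝓘(ℝ, E) 𝓘(ℝ, E) φ (σ z) :=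
    mdifferentiableAt_extChartAt (by rwa [extChartAt_source] at hz)
  have hτ : MDifferentiableAt 𝓘(ℝ, Y) 𝓘(ℝ, E) (fun z => φ (σ z)) z :=
    hφ.comp z (hσz.mdifferentiableAt (by simp))
  have hsymm : MDifferentiableAt 𝓘(ℝ, E) 𝓘(ℝ, E) φ.symm (φ (σ z)) := by
    have := mdifferentiableWithinAt_extChartAt_symm (I := 𝓘(ℝ, E)) (φ.map_source hz)
    rwa [modelWithCornersSelf_coe, range_id, mdifferentiableWithinAt_univ] at this
  have hcomp : mfderiv 𝓘(ℝ, Y) 𝓘(ℝ, E) σ z =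
      (mfderiv 𝓘(ℝ, E) 𝓘(ℝ, E) φ.symm (φ (σ z))).comp
        (mfderiv 𝓘(ℝ, Y) 𝓘(ℝ, E) (fun z => φ (σ z)) z) := by
    rw [← mfderiv_comp z hsymm hτ]
    apply Filter.EventuallyEq.mfderiv_eq
    filter_upwards [hz'] with w hw
    exact (φ.left_inv hw).symm
  ext v
  have key : ∀ i, mfderiv 𝓘(ℝ, Y) 𝓘(ℝ, E) σ z (v i) =
      mfderiv 𝓘(ℝ, E) 𝓘(ℝ, E) φ.symm (φ (σ z)) (fderiv ℝ (fun z => φ (σ z)) z (v i)) := by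
    intro i
    rw [← mfderiv_eq_fderiv]
    exact congrArg (fun L => L (v i)) hcomp
  have hp : φ.symm (φ (σ z)) = σ z := φ.left_inv hz
  change η (σ z) (fun i => mfderiv 𝓘(ℝ, Y) 𝓘(ℝ, E) σ z (v i)) =
    η (φ.symm (φ (σ z))) (fun i => mfderiv 𝓘(ℝ, E) 𝓘(ℝ, E) φ.symm (φ (σ z))
      (fderiv ℝ (fun z => φ (σ z)) z (v i)))
  have : ∀ (p q : N) (h : p = q) (u : Fin k → E),
    (η p : E [⋀^Fin k]→L[ℝ] ℝ) u = (η q : E [⋀^Fin k]→L[ℝ] ℝ) u := by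
    rintro p _ rfl u; rfl
  exact (this _ _ hp.symm _).trans (congrArg (η (φ.symm (φ (σ z))) : (Fin k → E) → ℝ) (funext key))

theorem IsSmooth.contDiffAt_inChart {η : DiffForm E N k} (hη : η.IsSmooth) (x : N) :
    ContDiffAt ℝ ∞ (η.inChart x) (extChartAt 𝓘(ℝ, E) x x) :=
  (hη x).contDiffAt (extChartAt_target_mem_nhds (I := 𝓘(ℝ, E)) x)

theorem contDiffAt_extChartAt_comp {σ : Y → N} {y : Y}
    (hσ : ContMDiffAt 𝓘(ℝ, Y) 𝓘(ℝ, E) ∞ σ y) :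
    ContDiffAt ℝ ∞ (fun z => extChartAt 𝓘(ℝ, E) (σ y) (σ z)) y :=
  ((contMDiffAt_extChartAt (I := 𝓘(ℝ, E)) (n := ∞)).comp y hσ).contDiffAt

variable [IsManifold 𝓘(ℝ, E) ∞ N]

theorem IsSmooth.differentiableAt_pullbackVec {η : DiffForm E N k} (hη : η.IsSmooth)
    {σ : Y → N} {y : Y} (hσ : ContMDiffAt 𝓘(ℝ, Y) 𝓘(ℝ, E) ∞ σ y) :
    DifferentiableAt ℝ (η.pullbackVec σ) y := by
  refine DifferentiableAt.congr_of_eventuallyEq ?_ (η.pullbackVec_eventuallyEq hσ)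
  have hτ := contDiffAt_extChartAt_comp hσ
  exact (((hη.contDiffAt_inChart (σ y)).differentiableAt (by simp)).comp y
    (hτ.differentiableAt (by simp))).continuousAlternatingMapCompContinuousLinearMap
    ((hτ.fderiv_right (m := ∞) (by simp)).differentiableAt (by simp))

theorem IsSmooth.contDiffAt_pullbackVec {η : DiffForm E N 1} (hη : η.IsSmooth) {σ : Y → N} {y : Y}
    (hσ : ContMDiffAt 𝓘(ℝ, Y) 𝓘(ℝ, E) ∞ σ y) (w : Y) :
    ContDiffAt ℝ ∞ (fun z => η.pullbackVec σ z ![w]) y := by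
  have hτ := contDiffAt_extChartAt_comp hσ
  have h1 : ContDiffAt ℝ ∞ (fun z => η.inChart (σ y) (extChartAt 𝓘(ℝ, E) (σ y) (σ z))) y :=
    ContDiffAt.comp (g := η.inChart (σ y)) y (hη.contDiffAt_inChart (σ y)) hτ
  have h2 : ContDiffAt ℝ ∞ (fderiv ℝ (fun z => extChartAt 𝓘(ℝ, E) (σ y) (σ z))) y :=
    hτ.fderiv_right (by simp)
  have h3 := ((ContinuousAlternatingMap.ofSubsingletonLIE (𝕜 := ℝ)
    (E := E) (F := ℝ) (ι := Fin 1) 0).symm.toContinuousLinearEquiv.contDiff.contDiffAt.comp y h1).clm_apply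
    (h2.clm_apply (contDiffAt_const (c := w)))
  refine h3.congr_of_eventuallyEq ?_
  filter_upwards [η.pullbackVec_eventuallyEq hσ] with z hz
  rw [hz]
  refine congrArg (η.inChart (σ y) (extChartAt 𝓘(ℝ, E) (σ y) (σ z)) : (Fin 1 → E) → ℝ)
    (funext fun i => ?_)
  fin_cases i
  rfl

theorem IsSmooth.extDeriv_pullbackVec {η : DiffForm E N k} (hη : η.IsSmooth) {σ : Y → N} {y : Y}
    (hσ : ContMDiffAt 𝓘(ℝ, Y) 𝓘(ℝ, E) ∞ σ y) :
    extDeriv (η.pullbackVec σ) y = η.d.pullbackVec σ y := by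
  rw [(η.pullbackVec_eventuallyEq hσ).extDeriv_eq]
  have hτ := contDiffAt_extChartAt_comp hσ
  rw [extDeriv_pullback (f := fun z => extChartAt 𝓘(ℝ, E) (σ y) (σ z)) (r := ∞)
    ((hη.contDiffAt_inChart (σ y)).differentiableAt (by simp)) hτ
    (by rw [minSmoothness_of_isRCLikeNormedField]; exact WithTop.coe_le_coe.2 (le_top (a := (2 : ℕ∞))))]
  have hσ' : MDifferentiableAt 𝓘(ℝ, Y) 𝓘(ℝ, E) σ y := hσ.mdifferentiableAt (by simp)
  have hφ : MDifferentiableAt 𝓘(ℝ, E) 𝓘(ℝ, E) (extChartAt 𝓘(ℝ, E) (σ y)) (σ y) :=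
    mdifferentiableAt_extChartAt (mem_chart_source _ _)
  ext v
  rw [pullbackVec_apply]
  change extDeriv (η.inChart (σ y)) _ (fun i => fderiv ℝ _ y (v i)) =
    extDeriv (η.inChart (σ y)) _ (fun i => mfderiv 𝓘(ℝ, E) 𝓘(ℝ, E) _ (σ y)
      (mfderiv 𝓘(ℝ, Y) 𝓘(ℝ, E) σ y (v i)))
  congr 1
  ext i
  rw [← mfderiv_eq_fderiv]
  exact congrArg (fun L => L (v i)) (mfderiv_comp y hφ hσ')

/-- `d η (σ_* u, σ_* w) = ∂_u (η (σ_* w)) - ∂_w (η (σ_* u))` for a 1-form `η`. -/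
theorem IsSmooth.d_apply_mfderiv {η : DiffForm E N 1} (hη : η.IsSmooth) {σ : Y → N} {y : Y}
    (hσ : ContMDiffAt 𝓘(ℝ, Y) 𝓘(ℝ, E) ∞ σ y) (u w : Y) :
    η.d (σ y) ![mfderiv 𝓘(ℝ, Y) 𝓘(ℝ, E) σ y u, mfderiv 𝓘(ℝ, Y) 𝓘(ℝ, E) σ y w] =
      fderiv ℝ (fun z => η.pullbackVec σ z ![w]) y u -
        fderiv ℝ (fun z => η.pullbackVec σ z ![u]) y w := by
  have e0 : (0 : Fin 2).removeNth ![u, w] = ![w] := by ext i; fin_cases i; rfl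
  have e1 : (1 : Fin 2).removeNth ![u, w] = ![u] := by ext i; fin_cases i; rfl
  have h := extDeriv_apply (hη.differentiableAt_pullbackVec hσ) ![u, w]
  rw [Fin.sum_univ_two, e0, e1] at h
  simp only [Fin.val_zero, pow_zero, one_smul, Fin.val_one, pow_one, Matrix.cons_val_zero,
    Matrix.cons_val_one, neg_smul, ← sub_eq_add_neg] at h
  rw [← h, hη.extDeriv_pullbackVec hσ, pullbackVec_apply]
  congr 1
  ext i
  fin_cases i <;> rfl

end DiffForm

/-! ### From local flows to a global flow on a compact manifold. -/

section Flow

variable {E : Type*} [NormedAddCommGroup E] [NormedSpace ℝ E]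
  {N : Type*} [TopologicalSpace N] [ChartedSpace E N]

/-- Near `x₀`, the vector field `v` has a smooth local flow. -/
def HasLocalFlowAt (v : ∀ x : N, TangentSpace 𝓘(ℝ, E) x) (x₀ : N) : Prop :=
  ∃ G : ℝ → N → N, ∃ ε > 0, ∃ O ∈ 𝓝 x₀,
    (∀ t ∈ Ioo (-ε) ε, ∀ x ∈ O,
      ContMDiffAt (𝓘(ℝ, ℝ).prod 𝓘(ℝ, E)) 𝓘(ℝ, E) ∞ (Function.uncurry G) (t, x)) ∧
    (∀ x ∈ O, G 0 x = x) ∧ ∀ x ∈ O, IsMIntegralCurveOn (fun t => G t x) v (Ioo (-ε) ε)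

/-- The field is the time derivative at 0 of a jointly smooth map. This supplies the regularity
required for uniqueness of integral curves. -/
theorem HasLocalFlowAt.contMDiffAt [IsManifold 𝓘(ℝ, E) ∞ N]
    {v : ∀ x : N, TangentSpace 𝓘(ℝ, E) x} {x₀ : N} (h : HasLocalFlowAt v x₀) :
    ContMDiffAt 𝓘(ℝ, E) 𝓘(ℝ, E).tangent ∞ (fun x => (⟨x, v x⟩ : TangentBundle 𝓘(ℝ, E) N)) x₀ := by
  obtain ⟨G, ε, hε, O, hO, hG, hG0, hGv⟩ := h
  have : IsManifold 𝓘(ℝ, E) 1 N := IsManifold.of_le (n := ∞) (by simp)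
  have hx₀ : x₀ ∈ O := mem_of_mem_nhds hO
  have h0 : (0 : ℝ) ∈ Ioo (-ε) ε := by simp [hε]
  have hsm : ContMDiffAt (𝓘(ℝ, E).prod 𝓘(ℝ, ℝ)) 𝓘(ℝ, E) ∞
      (Function.uncurry fun x t => G t x) (x₀, (0 : ℝ)) :=
    (hG 0 h0 x₀ hx₀).comp (x₀, (0 : ℝ)) (contMDiffAt_snd.prodMk contMDiffAt_fst)
  have key := ContMDiffAt.mfderiv (m := ∞) (fun x t => G t x) (fun _ => (0 : ℝ)) hsm
    contMDiffAt_const (by simp)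
  have hone : ContMDiffAt 𝓘(ℝ, E) 𝓘(ℝ, ℝ).tangent ∞
      (fun _ : N => (⟨0, (1 : ℝ)⟩ : TangentBundle 𝓘(ℝ, ℝ) ℝ)) x₀ := contMDiffAt_const
  have hG0' : (fun x => G 0 x) =ᶠ[𝓝 x₀] id := by
    filter_upwards [hO] with x hx using hG0 x hx
  have := ContMDiffAt.clm_apply_of_inCoordinates key hone
    (contMDiffAt_id.congr_of_eventuallyEq hG0')
  refine this.congr_of_eventuallyEq ?_
  filter_upwards [hO] with x hx
  have hd : mfderiv 𝓘(ℝ, ℝ) 𝓘(ℝ, E) (fun t => G t x) 0 =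
      (1 : ℝ →L[ℝ] ℝ).smulRight (v (G 0 x)) :=
    ((hGv x hx 0 h0).hasMFDerivAt (Ioo_mem_nhds h0.1 h0.2)).mfderiv
  have h1 : mfderiv 𝓘(ℝ, ℝ) 𝓘(ℝ, E) (fun t => G t x) 0 (1 : ℝ) = v (G 0 x) := by
    rw [hd]
    exact one_smul ℝ _
  rw [h1]
  exact (congrArg (fun y => (⟨y, v y⟩ : TangentBundle 𝓘(ℝ, E) N)) (hG0 x hx)).symm

theorem HasLocalFlowAt.integralCurve_unique [IsManifold 𝓘(ℝ, E) ∞ N] [T2Space N] [CompleteSpace E]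
    {v : ∀ x : N, TangentSpace 𝓘(ℝ, E) x} (h : ∀ x, HasLocalFlowAt v x) {γ γ' : ℝ → N}
    (hγ : IsMIntegralCurve γ v) (hγ' : IsMIntegralCurve γ' v) (h0 : γ 0 = γ' 0) (t : ℝ) :
    γ t = γ' t := by
  have : IsManifold 𝓘(ℝ, E) 1 N := IsManifold.of_le (n := ∞) (by simp)
  have hv : ContMDiff 𝓘(ℝ, E) 𝓘(ℝ, E).tangent 1
      (fun x => (⟨x, v x⟩ : TangentBundle 𝓘(ℝ, E) N)) := fun x =>
    (h x).contMDiffAt.of_le (by simp)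
  exact congrFun (isMIntegralCurve_Ioo_eq_of_contMDiff_boundaryless hv hγ hγ' h0) t

/-- A vector field on a compact manifold with smooth local flows has a smooth global flow. -/
theorem exists_global_flow [IsManifold 𝓘(ℝ, E) ∞ N] [T2Space N] [CompactSpace N] [CompleteSpace E]
    {v : ∀ x : N, TangentSpace 𝓘(ℝ, E) x} (h : ∀ x, HasLocalFlowAt v x) :
    ∃ F : ℝ → N → N,
      ContMDiff (𝓘(ℝ, ℝ).prod 𝓘(ℝ, E)) 𝓘(ℝ, E) ∞ (Function.uncurry F) ∧
      (∀ x, F 0 x = x) ∧ (∀ s t x, F (s + t) x = F s (F t x)) ∧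
      ∀ x, IsMIntegralCurve (fun t => F t x) v := by
  have : IsManifold 𝓘(ℝ, E) 1 N := IsManifold.of_le (n := ∞) (by simp)
  have hv : ContMDiff 𝓘(ℝ, E) 𝓘(ℝ, E).tangent 1
      (fun x => (⟨x, v x⟩ : TangentBundle 𝓘(ℝ, E) N)) := fun x =>
    (h x).contMDiffAt.of_le (by simp)
  choose G ε hε O hO hG hG0 hGv using h
  -- A finite subcover gives a uniform existence time, which lets every integral curve be continued
  -- to all of ℝ.
  obtain ⟨δ, hδ, hδx⟩ : ∃ δ > 0, ∀ x : N, ∃ y, x ∈ interior (O y) ∧ δ ≤ ε y := by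
    obtain ⟨s, hs⟩ := isCompact_univ.elim_finite_subcover (fun y => interior (O y))
      (fun y => isOpen_interior)
      (fun y _ => mem_iUnion.2 ⟨y, mem_interior_iff_mem_nhds.2 (hO y)⟩)
    rcases s.eq_empty_or_nonempty with rfl | hne
    · exact ⟨1, one_pos, fun x => by simpa using hs (mem_univ x)⟩
    · obtain ⟨y₀, hy₀, hmin⟩ := s.exists_min_image ε hne
      refine ⟨ε y₀, hε y₀, fun x => ?_⟩
      obtain ⟨y, hy, hxy⟩ := mem_iUnion₂.1 (hs (mem_univ x))
      exact ⟨y, hxy, hmin y hy⟩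
  have hsub : ∀ {y}, δ ≤ ε y → Ioo (-δ) δ ⊆ Ioo (-ε y) (ε y) := fun hy =>
    Ioo_subset_Ioo (by linarith) hy
  have hglob : ∀ x, ∃ γ : ℝ → N, γ 0 = x ∧ IsMIntegralCurve γ v := by
    refine exists_isMIntegralCurve_of_isMIntegralCurveOn hv hδ fun x => ?_
    obtain ⟨y, hxy, hy⟩ := hδx x
    exact ⟨fun t => G y t x, hG0 y x (interior_subset hxy),
      (hGv y x (interior_subset hxy)).mono (hsub hy)⟩
  choose γ hγ0 hγ using hglob
  have hadd : ∀ s t x, γ x (s + t) = γ (γ x t) s := by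
    intro s t x
    have := isMIntegralCurve_Ioo_eq_of_contMDiff_boundaryless (t₀ := 0) hv ((hγ x).comp_add t)
      (hγ (γ x t)) (by simp [hγ0])
    exact congrFun this s
  have hloc : ∀ t ∈ Ioo (-δ) δ, ∀ x : N, ContMDiffAt (𝓘(ℝ, ℝ).prod 𝓘(ℝ, E)) 𝓘(ℝ, E) ∞
      (Function.uncurry fun t x => γ x t) (t, x) := by
    intro t ht x
    obtain ⟨y, hxy, hy⟩ := hδx x
    refine (hG y t (hsub hy ht) x (interior_subset hxy)).congr_of_eventuallyEq ?_
    filter_upwards [(isOpen_Ioo.prod isOpen_interior).mem_nhds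
      (show (t, x) ∈ Ioo (-δ) δ ×ˢ interior (O y) from ⟨ht, hxy⟩)]
    rintro ⟨t', x'⟩ ⟨ht', hx'⟩
    refine isMIntegralCurveOn_Ioo_eqOn_of_contMDiff_boundaryless (t₀ := 0) (a := -δ) (b := δ)
      (by simp [hδ]) hv ((hγ x').isMIntegralCurveOn _)
      ((hGv y x' (interior_subset hx')).mono (hsub hy)) ?_ ht'
    simp [hγ0, hG0 y x' (interior_subset hx')]
  have htime : ∀ t ∈ Ioo (-δ) δ, ContMDiff 𝓘(ℝ, E) 𝓘(ℝ, E) ∞ fun x => γ x t := fun t ht x =>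
    (hloc t ht x).comp x (contMDiffAt_const.prodMk contMDiffAt_id)
  have htime' : ∀ t, ContMDiff 𝓘(ℝ, E) 𝓘(ℝ, E) ∞ fun x => γ x t := by
    intro t
    -- Splitting `t` into `n` steps shorter than `δ` makes the time-`t` map an iterate of a smooth
    -- one.
    obtain ⟨n, hn⟩ := exists_nat_gt (|t| / δ)
    have hn0 : (0 : ℝ) < n := lt_of_le_of_lt (by positivity) hn
    have hmul : ∀ k : ℕ, ContMDiff 𝓘(ℝ, E) 𝓘(ℝ, E) ∞ fun x => γ x (k * (t / n)) := by
      intro k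
      induction k with
      | zero => simpa [hγ0] using! contMDiff_id
      | succ k ih =>
        have hs : t / n ∈ Ioo (-δ) δ := by
          rw [mem_Ioo, ← abs_lt, abs_div, abs_of_pos hn0, div_lt_iff₀ hn0]
          rwa [div_lt_iff₀ hδ, mul_comm] at hn
        have e : (fun x => γ x ((k + 1 : ℕ) * (t / n))) =
            (fun x => γ x (t / n)) ∘ fun x => γ x (k * (t / n)) := by
          funext x
          simp only [Function.comp]
          rw [← hadd]
          congr 1
          push_cast
          ring
        rw [e]
        exact (htime _ hs).comp ih
    have := hmul n
    rwa [mul_div_cancel₀ _ hn0.ne'] at this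
  refine ⟨fun t x => γ x t, ?_, hγ0, hadd, hγ⟩
  rintro ⟨t, x⟩
  -- Joint smoothness at time `t` reduces to joint smoothness at time 0, followed by the smooth
  -- time-`t` map.
  have e : (Function.uncurry fun t x => γ x t) =
      (fun x => γ x t) ∘ (Function.uncurry fun t x => γ x t) ∘
        (fun p : ℝ × N => (p.1 - t, p.2)) := by
    funext ⟨t', x'⟩
    simp only [Function.comp, Function.uncurry]
    rw [← hadd]
    congr 1
    ring
  rw [e]
  refine (htime' t).contMDiffAt.comp _ ?_
  refine ContMDiffAt.comp (t, x) (I' := 𝓘(ℝ, ℝ).prod 𝓘(ℝ, E)) (hloc _ (by simp [hδ]) x) ?_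
  refine ContMDiffAt.prodMk ?_ contMDiffAt_snd
  exact ((contDiff_id.sub contDiff_const).contMDiff (n := ∞)).contMDiffAt.comp (t, x)
    contMDiffAt_fst

end Flow

/-! ### Smooth primitives depending on parameters. -/

section ParametricPrimitive

open MeasureTheory

variable {Y : Type*} [NormedAddCommGroup Y] [NormedSpace ℝ Y]

theorem hasFDerivAt_parametric_integral [FiniteDimensional ℝ Y] {q : Y × ℝ → ℝ}
    (hq : ContDiff ℝ 1 q) (y : Y) :
    HasFDerivAt (fun y => ∫ s in (0 : ℝ)..1, q (y, s))
      (∫ s in (0 : ℝ)..1, (fderiv ℝ q (y, s)).comp (ContinuousLinearMap.inl ℝ Y ℝ)) y := by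
  have hd : Continuous fun p : Y × ℝ =>
      (fderiv ℝ q p).comp (ContinuousLinearMap.inl ℝ Y ℝ) :=
    (hq.continuous_fderiv one_ne_zero).clm_comp continuous_const
  have : ProperSpace Y := FiniteDimensional.proper ℝ Y
  -- A constant dominates the parameter derivative on the compact product of a ball with [0, 1], so
  -- one may differentiate under the integral.
  obtain ⟨C, hC⟩ := ((isCompact_closedBall y 1).prod (isCompact_Icc (a := (0 : ℝ)) (b := 1)))
    |>.exists_bound_of_continuousOn hd.continuousOn
  refine intervalIntegral.hasFDerivAt_integral_of_dominated_of_fderiv_le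
    (F' := fun y s => (fderiv ℝ q (y, s)).comp (ContinuousLinearMap.inl ℝ Y ℝ))
    (bound := fun _ => C) (Metric.closedBall_mem_nhds y one_pos) ?_ ?_ ?_ ?_ ?_ ?_
  · refine Eventually.of_forall fun z => Continuous.aestronglyMeasurable ?_
    exact hq.continuous.comp (by fun_prop)
  · exact (hq.continuous.comp (by fun_prop)).intervalIntegrable _ _
  · exact (hd.comp (f := fun s : ℝ => (y, s)) (by fun_prop)).aestronglyMeasurable
  · refine Eventually.of_forall fun s hs z hz => hC (z, s) ⟨hz, ?_⟩
    rw [uIoc_of_le zero_le_one] at hs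
    exact Ioc_subset_Icc_self hs
  · exact intervalIntegrable_const
  · refine Eventually.of_forall fun s _ z _ => ?_
    have h1 : HasFDerivAt q (fderiv ℝ q (z, s)) (z, s) :=
      (hq.differentiable one_ne_zero (z, s)).hasFDerivAt
    exact h1.comp (f := fun z : Y => (z, s)) z (hasFDerivAt_prodMk_left z s)

/-- Each directional derivative is again such an integral, of a function with one derivative fewer;
hence the induction. -/
theorem contDiff_parametric_integral [FiniteDimensional ℝ Y] (n : ℕ) :
    ∀ {q : Y × ℝ → ℝ}, ContDiff ℝ n q → ContDiff ℝ n fun y => ∫ s in (0 : ℝ)..1, q (y, s) := by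
  induction n with
  | zero =>
    intro q hq
    refine contDiff_zero.2 ?_
    exact intervalIntegral.continuous_parametric_intervalIntegral_of_continuous'
      (f := fun y s => q (y, s)) hq.continuous 0 1
  | succ n ih =>
    intro q hq
    have hq1 : ContDiff ℝ 1 q := hq.of_le (by simp)
    rw [show ((n + 1 : ℕ) : WithTop ℕ∞) = (n : WithTop ℕ∞) + 1 by push_cast; rfl] at hq ⊢
    rw [contDiff_succ_iff_fderiv_apply]
    refine ⟨fun y => (hasFDerivAt_parametric_integral hq1 y).differentiableAt, by simp, fun v => ?_⟩
    have e : (fun y => fderiv ℝ (fun y => ∫ s in (0 : ℝ)..1, q (y, s)) y v) =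
        fun y => ∫ s in (0 : ℝ)..1, fderiv ℝ q (y, s) (v, 0) := by
      funext y
      rw [(hasFDerivAt_parametric_integral hq1 y).fderiv,
        ContinuousLinearMap.intervalIntegral_apply]
      · rfl
      · refine Continuous.intervalIntegrable ?_ _ _
        exact ((hq1.continuous_fderiv one_ne_zero).comp (by fun_prop)).clm_comp continuous_const
    rw [e]
    exact ih ((hq.fderiv_right (m := n) le_rfl).clm_apply contDiff_const)

theorem contDiff_parametric_primitive [FiniteDimensional ℝ Y] {q : ℝ × Y → ℝ}
    (hq : ContDiff ℝ ∞ q) : ContDiff ℝ ∞ fun p : ℝ × Y => ∫ s in (0 : ℝ)..p.1, q (s, p.2) := by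
  -- Rescaling the variable moves the varying endpoint into the integrand.
  have e : (fun p : ℝ × Y => ∫ s in (0 : ℝ)..p.1, q (s, p.2)) =
      fun p => ∫ s in (0 : ℝ)..1, p.1 * q (p.1 * s, p.2) := by
    funext p
    rw [intervalIntegral.integral_const_mul, intervalIntegral.mul_integral_comp_mul_left
      (f := fun s => q (s, p.2))]
    simp
  rw [e, contDiff_infty]
  intro n
  refine contDiff_parametric_integral n (q := fun z : (ℝ × Y) × ℝ =>
    z.1.1 * q (z.1.1 * z.2, z.1.2)) ?_
  have hq' : ContDiff ℝ n q := hq.of_le (by exact_mod_cast le_top)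
  exact contDiff_fst.fst.mul (hq'.comp
    ((contDiff_fst.fst.mul contDiff_snd).prodMk contDiff_fst.snd))

/-- A function which is smooth near a point has a smooth extension of its germ. -/
theorem exists_contDiff_eventuallyEq [FiniteDimensional ℝ Y] {q : Y → ℝ} {y₀ : Y}
    (hq : ∀ᶠ y in 𝓝 y₀, ContDiffAt ℝ ∞ q y) : ∃ r : Y → ℝ, ContDiff ℝ ∞ r ∧ r =ᶠ[𝓝 y₀] q := by
  obtain ⟨ε, hε, hq⟩ := Metric.eventually_nhds_iff_ball.1 hq
  let χ : ContDiffBump y₀ := ⟨ε / 3, ε / 2, by positivity, by linarith⟩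
  refine ⟨fun y => χ y * q y, contDiff_iff_contDiffAt.2 fun y => ?_, ?_⟩
  · by_cases hy : y ∈ Metric.ball y₀ ε
    · exact χ.contDiffAt.mul (hq y hy)
    · refine (contDiffAt_const (c := (0 : ℝ))).congr_of_eventuallyEq ?_
      have : y ∉ tsupport χ := by
        rw [χ.tsupport_eq]
        intro h
        exact hy (Metric.closedBall_subset_ball (show ε / 2 < ε by linarith) h)
      filter_upwards [notMem_tsupport_iff_eventuallyEq.1 this] with z hz
      simp [hz]
  · filter_upwards [χ.eventuallyEq_one] with y hy
    simp [hy]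

theorem exists_smooth_primitive [FiniteDimensional ℝ Y] {q : ℝ × Y → ℝ} {y₀ : Y}
    (hq : ∀ᶠ p in 𝓝 ((0 : ℝ), y₀), ContDiffAt ℝ ∞ q p) :
    ∃ g : ℝ × Y → ℝ, ContDiff ℝ ∞ g ∧ (∀ y, g (0, y) = 0) ∧
      ∀ᶠ p in 𝓝 ((0 : ℝ), y₀), HasDerivAt (fun t => g (t, p.2)) (q p) p.1 := by
  obtain ⟨r, hr, hrq⟩ := exists_contDiff_eventuallyEq hq
  refine ⟨fun p => ∫ s in (0 : ℝ)..p.1, r (s, p.2), contDiff_parametric_primitive hr,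
    fun y => by simp, ?_⟩
  filter_upwards [hrq] with p hp
  rw [← hp]
  have hc : Continuous fun s => r (s, p.2) := hr.continuous.comp (by fun_prop)
  exact intervalIntegral.integral_hasDerivAt_right (hc.intervalIntegrable _ _)
    (hc.stronglyMeasurableAtFilter _ _) hc.continuousAt

end ParametricPrimitive

/-! ### Smoothness of the argument on the circle. -/

section CircleLog

theorem contMDiffAt_circle_arg {z : Circle} (hz : (z : ℂ) ∈ Complex.slitPlane) :
    ContMDiffAt (𝓡 1) 𝓘(ℝ, ℝ) ∞ (fun z : Circle => Complex.arg z) z := by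
  have : Fact (Module.finrank ℝ ℂ = 1 + 1) := ⟨Complex.finrank_real_complex⟩
  have h1 : ContDiffAt ℝ ∞ (fun w : ℂ => (Complex.log w).im) (z : ℂ) :=
    Complex.imCLM.contDiff.contDiffAt.comp (z : ℂ) ((Complex.contDiffAt_log hz).restrict_scalars ℝ)
  have h2 : ContMDiff (𝓡 1) 𝓘(ℝ, ℂ) ∞ (fun z : Circle => (z : ℂ)) :=
    contMDiff_coe_sphere (E := ℂ) (n := 1)
  have := h1.contMDiffAt.comp z h2.contMDiffAt
  simp only [Complex.log_im] at this
  exact this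

theorem eventually_contMDiffAt_circle_arg :
    ∀ᶠ z : Circle in 𝓝 1, ContMDiffAt (𝓡 1) 𝓘(ℝ, ℝ) ∞ (fun z : Circle => Complex.arg z) z := by
  have : ∀ᶠ z : Circle in 𝓝 1, (z : ℂ) ∈ Complex.slitPlane :=
    (show Continuous fun z : Circle => (z : ℂ) by fun_prop).continuousAt.eventually_mem
      (Complex.isOpen_slitPlane.mem_nhds (by simp))
  filter_upwards [this] with z hz using contMDiffAt_circle_arg hz

theorem contMDiff_circle_mul_right (w : Circle) :
    ContMDiff (𝓡 1) (𝓡 1) ∞ fun z : Circle => z * w := by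
  have : LieGroup (𝓡 1) ∞ Circle := LieGroup.of_le (n := ω) le_top
  exact contMDiff_mul_right

end CircleLog

/-! ### Orbits and derivatives of a circle action. -/

namespace SmoothCircleAction

variable {E : Type*} [NormedAddCommGroup E] [NormedSpace ℝ E]
  {N : Type*} [TopologicalSpace N] [ChartedSpace E N] (A : SmoothCircleAction E N)

theorem act_one (x : N) : A.act 1 x = x := A.toMulAction.one_smul x

theorem act_mul (g h : Circle) (x : N) : A.act (g * h) x = A.act g (A.act h x) :=
  A.toMulAction.mul_smul g h x

theorem contMDiff_act : ContMDiff ((𝓡 1).prod 𝓘(ℝ, E)) 𝓘(ℝ, E) ∞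
    fun p : Circle × N => A.act p.1 p.2 :=
  A.contMDiffSMul.contMDiff_smul

theorem contMDiff_act_right (g : Circle) : ContMDiff 𝓘(ℝ, E) 𝓘(ℝ, E) ∞ (A.act g) :=
  A.contMDiff_act.comp (contMDiff_const.prodMk contMDiff_id)

theorem contMDiff_act_exp : ContMDiff (𝓘(ℝ, ℝ).prod 𝓘(ℝ, E)) 𝓘(ℝ, E) ∞
    fun p : ℝ × N => A.act (Circle.exp p.1) p.2 :=
  A.contMDiff_act.comp ((contMDiff_circleExp.comp contMDiff_fst).prodMk contMDiff_snd)

theorem contMDiff_act_exp_left (x : N) : ContMDiff 𝓘(ℝ, ℝ) 𝓘(ℝ, E) ∞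
    fun t : ℝ => A.act (Circle.exp t) x :=
  A.contMDiff_act_exp.comp (contMDiff_id.prodMk contMDiff_const)

/-- The group law moves time `t` to time 0, where the derivative is the generator by definition. -/
theorem hasMFDerivAt_orbit (x : N) (t : ℝ) :
    HasMFDerivAt 𝓘(ℝ, ℝ) 𝓘(ℝ, E) (fun t : ℝ => A.act (Circle.exp t) x) t
      ((1 : ℝ →L[ℝ] ℝ).smulRight (A.generator (A.act (Circle.exp t) x))) := by
  set y := A.act (Circle.exp t) x
  have h0 : HasMFDerivAt 𝓘(ℝ, ℝ) 𝓘(ℝ, E) (fun s : ℝ => A.act (Circle.exp s) y) (t - t)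
      ((1 : ℝ →L[ℝ] ℝ).smulRight (A.generator y)) := by
    rw [sub_self]
    have := ((A.contMDiff_act_exp_left y).contMDiffAt (x := 0)).mdifferentiableAt
      (by simp) |>.hasMFDerivAt
    refine this.congr_mfderiv ?_
    ext
    exact (one_smul ℝ (A.generator y)).symm
  have h1 : HasMFDerivAt 𝓘(ℝ, ℝ) 𝓘(ℝ, ℝ) (fun s : ℝ => s - t) t
      (ContinuousLinearMap.id ℝ ℝ) :=
    ((hasFDerivAt_id t).sub_const t).hasMFDerivAt
  have h2 := HasMFDerivAt.comp (f := fun s : ℝ => s - t) t h0 h1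
  have e : (fun t : ℝ => A.act (Circle.exp t) x) =
      (fun s : ℝ => A.act (Circle.exp s) y) ∘ fun s => s - t := by
    funext s
    simp only [Function.comp, y]
    rw [← A.act_mul, ← Circle.exp_add, sub_add_cancel]
  rw [e]
  exact h2

theorem isMIntegralCurve_orbit (x : N) :
    IsMIntegralCurve (fun t : ℝ => A.act (Circle.exp t) x) A.generator :=
  A.hasMFDerivAt_orbit x

theorem hasLocalFlowAt_generator (x : N) : HasLocalFlowAt A.generator x :=
  ⟨fun t x => A.act (Circle.exp t) x, 1, one_pos, univ, univ_mem,
    fun _ _ _ _ => A.contMDiff_act_exp.contMDiffAt,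
    fun x _ => by simp only [Circle.exp_zero, A.act_one],
    fun x _ => (A.isMIntegralCurve_orbit x).isMIntegralCurveOn _⟩

variable {F : Type*} [NormedAddCommGroup F] [NormedSpace ℝ F]
  {Z : Type*} [TopologicalSpace Z] [ChartedSpace F Z]

theorem mdifferentiableAt_act_exp {u : Z → ℝ} {k : Z → N} {z : Z}
    (hu : MDifferentiableAt 𝓘(ℝ, F) 𝓘(ℝ, ℝ) u z) (hk : MDifferentiableAt 𝓘(ℝ, F) 𝓘(ℝ, E) k z) :
    MDifferentiableAt 𝓘(ℝ, F) 𝓘(ℝ, E) (fun z => A.act (Circle.exp (u z)) (k z)) z :=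
  (A.contMDiff_act_exp.mdifferentiableAt (by simp) (x := (u z, k z))).comp z (hu.prodMk hk)

theorem mfderiv_act_exp {u : Z → ℝ} {k : Z → N} {z : Z}
    (hu : MDifferentiableAt 𝓘(ℝ, F) 𝓘(ℝ, ℝ) u z) (hk : MDifferentiableAt 𝓘(ℝ, F) 𝓘(ℝ, E) k z)
    (w : TangentSpace 𝓘(ℝ, F) z) :
    mfderiv 𝓘(ℝ, F) 𝓘(ℝ, E) (fun z => A.act (Circle.exp (u z)) (k z)) z w =
      mvfderiv 𝓘(ℝ, F) u z w • A.generator (A.act (Circle.exp (u z)) (k z)) +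
        mfderiv 𝓘(ℝ, E) 𝓘(ℝ, E) (A.act (Circle.exp (u z))) (k z)
          (mfderiv 𝓘(ℝ, F) 𝓘(ℝ, E) k z w) := by
  have hρ : MDifferentiableAt (𝓘(ℝ, ℝ).prod 𝓘(ℝ, E)) 𝓘(ℝ, E)
      (fun p : ℝ × N => A.act (Circle.exp p.1) p.2) (u z, k z) :=
    A.contMDiff_act_exp.mdifferentiableAt (by simp)
  have h1 : mfderiv 𝓘(ℝ, F) 𝓘(ℝ, E) (fun z => A.act (Circle.exp (u z)) (k z)) z =
      (mfderiv (𝓘(ℝ, ℝ).prod 𝓘(ℝ, E)) 𝓘(ℝ, E)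
        (fun p : ℝ × N => A.act (Circle.exp p.1) p.2) (u z, k z)).comp
      (mfderiv 𝓘(ℝ, F) (𝓘(ℝ, ℝ).prod 𝓘(ℝ, E)) (fun z => (u z, k z)) z) :=
    mfderiv_comp z hρ (hu.prodMk hk)
  rw [h1, mfderiv_prodMk hu hk]
  refine (mfderiv_prod_eq_add_apply hρ).trans ?_
  congr 1
  have := (A.hasMFDerivAt_orbit (k z) (u z)).mfderiv
  exact congrArg (fun L => L (mfderiv 𝓘(ℝ, F) 𝓘(ℝ, ℝ) u z w)) this

end SmoothCircleAction

theorem DiffForm.apply_add {E : Type*} [NormedAddCommGroup E] [NormedSpace ℝ E]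
    {N : Type*} [TopologicalSpace N] [ChartedSpace E N] (η : DiffForm E N 1) (x : N)
    (v w : TangentSpace 𝓘(ℝ, E) x) : η x ![v + w] = η x ![v] + η x ![w] :=
  (η x).cons_add ![] v w

theorem DiffForm.apply_smul {E : Type*} [NormedAddCommGroup E] [NormedSpace ℝ E]
    {N : Type*} [TopologicalSpace N] [ChartedSpace E N] (η : DiffForm E N 1) (x : N)
    (c : ℝ) (v : TangentSpace 𝓘(ℝ, E) x) : η x ![c • v] = c * η x ![v] :=
  (η x).cons_smul ![] c v

theorem DiffForm.apply_sub {E : Type*} [NormedAddCommGroup E] [NormedSpace ℝ E]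
    {N : Type*} [TopologicalSpace N] [ChartedSpace E N] (η : DiffForm E N 1) (x : N)
    (v w : TangentSpace 𝓘(ℝ, E) x) : η x ![v - w] = η x ![v] - η x ![w] := by
  rw [sub_eq_add_neg, ← neg_one_smul ℝ w, η.apply_add, η.apply_smul]
  ring

/-! ### Geometry of principal circle bundles and connections. -/

section PrincipalBundle

variable {E : Type*} [NormedAddCommGroup E] [NormedSpace ℝ E]
  {B : Type*} [TopologicalSpace B] [ChartedSpace E B]
  {E' : Type*} [NormedAddCommGroup E'] [NormedSpace ℝ E']
  {M : Type*} [TopologicalSpace M] [ChartedSpace E' M]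

namespace IsPrincipalCircleBundle

variable {P : SmoothCircleAction E' M} {π : M → B} (h : IsPrincipalCircleBundle (E := E) P π)
include h

/-- Through every point there is a smooth local section, and the angle to that section is a smooth
function near that point. -/
theorem exists_section_angle (x₀ : M) : ∃ (U : Set B) (s : B → M) (θ : M → ℝ),
    IsOpen U ∧ π x₀ ∈ U ∧ (∀ b ∈ U, ContMDiffAt 𝓘(ℝ, E) 𝓘(ℝ, E') ∞ s b) ∧
    (∀ b ∈ U, π (s b) = b) ∧ (∀ x, π x ∈ U → P.act (Circle.exp (θ x)) (s (π x)) = x) ∧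
    θ x₀ = 0 ∧ ∀ᶠ x in 𝓝 x₀, ContMDiffAt 𝓘(ℝ, E') 𝓘(ℝ, ℝ) ∞ θ x := by
  obtain ⟨e, he, hsm, hsymm, heq⟩ := h.locally_trivial (π x₀)
  obtain ⟨a, ha⟩ : ∃ a : Circle → ℝ, a = fun z : Circle => Complex.arg z := ⟨_, rfl⟩
  have hexp : ∀ z : Circle, Circle.exp (a z) = z := fun z => by rw [ha]; exact Circle.exp_arg z
  have ha1 : a 1 = 0 := by simp [ha]
  have hasm := eventually_contMDiffAt_circle_arg
  rw [← ha] at hasm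
  have hx₀ : x₀ ∈ e.source := e.mem_source.2 he
  -- Starting the section at the fibre coordinate of `x₀` makes the angle 0 there, so near `x₀` the
  -- argument stays off its branch cut.
  set z₀ := (e x₀).2
  have hs : ∀ b ∈ e.baseSet, (b, z₀) ∈ e.target := fun b hb => e.mem_target.2 hb
  have hsource : ∀ b ∈ e.baseSet, e.toOpenPartialHomeomorph.symm (b, z₀) ∈ e.source := fun b hb =>
    e.toOpenPartialHomeomorph.map_target (hs b hb)
  have hes : ∀ b ∈ e.baseSet, e (e.toOpenPartialHomeomorph.symm (b, z₀)) = (b, z₀) := fun b hb =>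
    e.toOpenPartialHomeomorph.right_inv (hs b hb)
  have hπ : ∀ b ∈ e.baseSet, π (e.toOpenPartialHomeomorph.symm (b, z₀)) = b := fun b hb => by
    rw [← e.coe_fst (hsource b hb), hes b hb]
  refine ⟨e.baseSet, fun b => e.toOpenPartialHomeomorph.symm (b, z₀),
    fun x => a ((e x).2 * z₀⁻¹), e.open_baseSet, he, ?_, hπ, ?_, ?_, ?_⟩
  · intro b hb
    exact (hsymm.contMDiffAt (e.open_target.mem_nhds (hs b hb))).comp b
      (contMDiffAt_id.prodMk contMDiffAt_const)
  · intro x hx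
    have hxs : x ∈ e.source := e.mem_source.2 hx
    have h1 := heq (Circle.exp (a ((e x).2 * z₀⁻¹))) _ (hsource _ hx)
    have h2 : P.act (Circle.exp (a ((e x).2 * z₀⁻¹)))
        (e.toOpenPartialHomeomorph.symm (π x, z₀)) ∈ e.source := by
      rw [e.mem_source, h.invariant, hπ _ hx]
      exact hx
    refine e.injOn h2 hxs (h1.trans ?_)
    rw [hπ _ hx, hes _ hx, hexp, inv_mul_cancel_right]
    exact Prod.ext (e.coe_fst hxs).symm rfl
  · simp only [z₀, mul_inv_cancel, ha1]
  · have hc : ∀ x ∈ e.source, ContMDiffAt 𝓘(ℝ, E') (𝓡 1) ∞ (fun x => (e x).2 * z₀⁻¹) x :=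
      fun x hx => (contMDiff_circle_mul_right z₀⁻¹).contMDiffAt.comp x
        (contMDiffAt_snd.comp x (hsm.contMDiffAt (e.open_source.mem_nhds hx)))
    have ht : Tendsto (fun x => (e x).2 * z₀⁻¹) (𝓝 x₀) (𝓝 1) := by
      have := (hc x₀ hx₀).continuousAt.tendsto
      simpa only [mul_inv_cancel, z₀] using this
    filter_upwards [e.open_source.mem_nhds hx₀, ht.eventually hasm]
      with x hx hx'
    exact hx'.comp x (hc x hx)

theorem surjective : Function.Surjective π := by
  intro b
  obtain ⟨e, he, -⟩ := h.locally_trivial b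
  refine ⟨e.toOpenPartialHomeomorph.symm (b, 1), ?_⟩
  have ht : (b, (1 : Circle)) ∈ e.target := e.mem_target.2 he
  rw [← e.coe_fst (e.toOpenPartialHomeomorph.map_target ht)]
  exact congrArg Prod.fst (e.toOpenPartialHomeomorph.right_inv ht)

theorem eq_one_of_act_eq_self {g : Circle} {x : M} (hg : P.act g x = x) : g = 1 := by
  obtain ⟨e, he, -, -, heq⟩ := h.locally_trivial (π x)
  have := congrArg Prod.snd (heq g x (e.mem_source.2 he))
  rw [hg] at this
  exact (mul_eq_right.1 this.symm)

theorem isOpenMap : IsOpenMap π := by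
  refine isOpenMap_iff_nhds_le.2 fun x => ?_
  obtain ⟨U, s, θ, hU, hxU, hs, hπs, hact, hθ, -⟩ := h.exists_section_angle x
  intro V hV
  have hsx : s (π x) = x := by
    have := hact x hxU
    rwa [hθ, Circle.exp_zero, P.act_one] at this
  have h1 : s ⁻¹' (π ⁻¹' V) ∈ 𝓝 (π x) :=
    (hs _ hxU).continuousAt.preimage_mem_nhds (by rw [hsx]; exact hV)
  filter_upwards [h1, hU.mem_nhds hxU] with b hb hbU
  have : π (s b) ∈ V := hb
  rwa [hπs b hbU] at this

/-- M is covered by finitely many continuous images of circle × compact set, the compact sets lying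
under local sections. -/
theorem compactSpace [CompactSpace B] [T2Space B] : CompactSpace M := by
  choose x hx using h.surjective
  choose U s θ hU hxU hs hπs hact _ _ using fun b => h.exists_section_angle (x b)
  have hbU : ∀ b, U b ∈ 𝓝 b := fun b => by
    have := (hU b).mem_nhds (hxU b)
    rwa [hx b] at this
  choose K hK hKU hKc using fun b => local_compact_nhds (hbU b)
  obtain ⟨t, ht⟩ := isCompact_univ.elim_finite_subcover (fun b => interior (K b))
    (fun _ => isOpen_interior)
    (fun b _ => mem_iUnion.2 ⟨b, mem_interior_iff_mem_nhds.2 (hK b)⟩)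
  have hc : IsCompact (⋃ b ∈ t, (fun p : Circle × B => P.act p.1 (s b p.2)) '' (univ ×ˢ K b)) := by
    refine t.isCompact_biUnion fun b _ => (isCompact_univ.prod (hKc b)).image_of_continuousOn ?_
    have h2 : ContinuousOn (fun p : Circle × B => (p.1, s b p.2)) (univ ×ˢ K b) := by
      refine continuousOn_fst.prodMk (ContinuousOn.comp (t := K b) ?_ continuousOn_snd fun p hp => hp.2)
      exact fun c hc => (hs b c (hKU b hc)).continuousAt.continuousWithinAt
    exact P.contMDiff_act.continuous.comp_continuousOn h2
  refine ⟨hc.of_isClosed_subset isClosed_univ fun y _ => ?_⟩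
  obtain ⟨b, hb, hyb⟩ := mem_iUnion₂.1 (ht (mem_univ (π y)))
  exact mem_iUnion₂.2 ⟨b, hb, (Circle.exp (θ b y), π y), ⟨mem_univ _, interior_subset hyb⟩,
    hact b y (hKU b (interior_subset hyb))⟩

theorem mdifferentiable : MDifferentiable 𝓘(ℝ, E') 𝓘(ℝ, E) π := h.smooth.mdifferentiable (by simp)

theorem mfderiv_generator (x : M) : mfderiv 𝓘(ℝ, E') 𝓘(ℝ, E) π x (P.generator x) = 0 := by
  have h1 := (h.mdifferentiable (P.act (Circle.exp 0) x)).hasMFDerivAt.comp (0 : ℝ)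
    (P.hasMFDerivAt_orbit x 0)
  have e : π ∘ (fun t : ℝ => P.act (Circle.exp t) x) = fun _ => π x := by
    funext t
    exact h.invariant _ _
  rw [e] at h1
  have h2 := congrArg (fun L => L (1 : ℝ)) (hasMFDerivAt_unique h1 (hasMFDerivAt_const (π x) 0))
  have e0 : P.act (Circle.exp 0) x = x := by rw [Circle.exp_zero, P.act_one]
  rw [e0] at h2
  have h3 : mfderiv 𝓘(ℝ, E') 𝓘(ℝ, E) π x ((1 : ℝ) • P.generator x) = 0 := h2
  rwa [one_smul] at h3

theorem mfderiv_act (g : Circle) (x : M) (v : TangentSpace 𝓘(ℝ, E') x) :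
    mfderiv 𝓘(ℝ, E') 𝓘(ℝ, E) π (P.act g x) (mfderiv 𝓘(ℝ, E') 𝓘(ℝ, E') (P.act g) x v) =
      mfderiv 𝓘(ℝ, E') 𝓘(ℝ, E) π x v := by
  have h1 := mfderiv_comp x (h.mdifferentiable (P.act g x))
    ((P.contMDiff_act_right g).mdifferentiable (by simp) x)
  have e : π ∘ P.act g = π := funext fun y => h.invariant g y
  rw [e] at h1
  exact (congrArg (fun L => L v) h1).symm

end IsPrincipalCircleBundle

section Connection

variable {P : SmoothCircleAction E' M} {π : M → B} {α : DiffForm E' M 1}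

theorem IsConnectionForm.apply_mfderiv_act (hα : IsConnectionForm P α) (g : Circle) (x : M)
    (v : TangentSpace 𝓘(ℝ, E') x) :
    α (P.act g x) ![mfderiv 𝓘(ℝ, E') 𝓘(ℝ, E') (P.act g) x v] = α x ![v] := by
  have h1 := congrArg (fun L => L ![v]) (congrFun (hα.invariant g) x)
  rw [← h1]
  refine congrArg (α (P.act g x) : (Fin 1 → E') → ℝ) (funext fun i => ?_)
  fin_cases i
  rfl

variable {F : Type*} [NormedAddCommGroup F] [NormedSpace ℝ F]
  {Z : Type*} [TopologicalSpace Z] [ChartedSpace F Z]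

/-- The gauge formula (e^{iu}·k)^*α = du + k^*α. It produces the angle equation for the lifted flow
and shows that rotation angles of α-preserving maps are locally constant. -/
theorem IsConnectionForm.apply_mfderiv_act_exp (hα : IsConnectionForm P α) {u : Z → ℝ} {k : Z → M}
    {z : Z} (hu : MDifferentiableAt 𝓘(ℝ, F) 𝓘(ℝ, ℝ) u z)
    (hk : MDifferentiableAt 𝓘(ℝ, F) 𝓘(ℝ, E') k z) (w : TangentSpace 𝓘(ℝ, F) z) :
    α (P.act (Circle.exp (u z)) (k z))
        ![mfderiv 𝓘(ℝ, F) 𝓘(ℝ, E') (fun z => P.act (Circle.exp (u z)) (k z)) z w] =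
      mvfderiv 𝓘(ℝ, F) u z w + α (k z) ![mfderiv 𝓘(ℝ, F) 𝓘(ℝ, E') k z w] := by
  rw [P.mfderiv_act_exp hu hk w, α.apply_add, α.apply_smul, hα.normalized, mul_one,
    hα.apply_mfderiv_act]

/-- A tangent vector which is both vertical and horizontal vanishes. -/
theorem IsConnectionForm.eq_zero_of_horizontal (hα : IsConnectionForm P α)
    (h : IsPrincipalCircleBundle (E := E) P π) {x : M} {v : TangentSpace 𝓘(ℝ, E') x}
    (hv : mfderiv 𝓘(ℝ, E') 𝓘(ℝ, E) π x v = 0) (hαv : α x ![v] = 0) : v = 0 := by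
  obtain ⟨U, s, θ, hU, hxU, hs, hπs, hact, hθ, hθs⟩ := h.exists_section_angle x
  have hθd : MDifferentiableAt 𝓘(ℝ, E') 𝓘(ℝ, ℝ) θ x :=
    hθs.self_of_nhds.mdifferentiableAt (by simp)
  have hsd := (hs _ hxU).mdifferentiableAt (by simp)
  have hk : MDifferentiableAt 𝓘(ℝ, E') 𝓘(ℝ, E') (fun y => s (π y)) x :=
    hsd.comp x (h.mdifferentiable x)
  have hkv : mfderiv 𝓘(ℝ, E') 𝓘(ℝ, E') (fun y => s (π y)) x v = 0 := by
    have h1 : mfderiv 𝓘(ℝ, E') 𝓘(ℝ, E') (fun y => s (π y)) x v =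
        mfderiv 𝓘(ℝ, E) 𝓘(ℝ, E') s (π x) (mfderiv 𝓘(ℝ, E') 𝓘(ℝ, E) π x v) :=
      congrArg (fun L => L v) (mfderiv_comp x hsd (h.mdifferentiable x))
    rw [h1, hv, map_zero]
  -- Near `x` the identity is `exp θ` acting on `s ∘ π`. Differentiating along the vertical `v`
  -- leaves dθ(v) times the generator, whose coefficient α detects.
  have e : (fun y => P.act (Circle.exp (θ y)) (s (π y))) =ᶠ[𝓝 x] id := by
    filter_upwards [h.smooth.continuous.continuousAt.preimage_mem_nhds (hU.mem_nhds hxU)]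
      with y hy using hact y hy
  have h2 := P.mfderiv_act_exp hθd hk v
  rw [hkv, map_zero, add_zero, e.mfderiv_eq, mfderiv_id] at h2
  have h3 : v = mvfderiv 𝓘(ℝ, E') θ x v • P.generator x := by
    have e0 : P.act (Circle.exp (θ x)) (s (π x)) = x := hact x hxU
    rw [e0] at h2
    exact h2
  have h4 : α x ![v] = mvfderiv 𝓘(ℝ, E') θ x v := by
    conv_lhs => rw [h3]
    rw [α.apply_smul, hα.normalized, mul_one]
  rw [h3, ← h4, hαv, zero_smul]

/-- Push X forward by a local section, then subtract the vertical part measured by α. -/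
theorem IsConnectionForm.exists_horizontalLift (hα : IsConnectionForm P α)
    (h : IsPrincipalCircleBundle (E := E) P π) (X : ∀ b : B, TangentSpace 𝓘(ℝ, E) b) :
    ∃ Y : ∀ x : M, TangentSpace 𝓘(ℝ, E') x, IsHorizontalLift π α X Y := by
  suffices ∀ x : M, ∃ w : TangentSpace 𝓘(ℝ, E') x,
      α x ![w] = 0 ∧ mfderiv 𝓘(ℝ, E') 𝓘(ℝ, E) π x w = X (π x) by
    choose Y hY using this
    exact ⟨Y, hY⟩
  intro x
  suffices ∃ w : TangentSpace 𝓘(ℝ, E') x, mfderiv 𝓘(ℝ, E') 𝓘(ℝ, E) π x w = X (π x) by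
    obtain ⟨w, hw⟩ := this
    refine ⟨w + (-α x ![w]) • P.generator x, ?_, ?_⟩
    · rw [α.apply_add, α.apply_smul, hα.normalized, mul_one, add_neg_cancel]
    · rw [map_add, map_smul, h.mfderiv_generator, smul_zero, add_zero, hw]
  obtain ⟨U, s, θ, hU, hxU, hs, hπs, hact, hθ, -⟩ := h.exists_section_angle x
  have hsx : s (π x) = x := by
    have := hact x hxU
    rwa [hθ, Circle.exp_zero, P.act_one] at this
  have hsd := (hs _ hxU).mdifferentiableAt (by simp)
  have e : π ∘ s =ᶠ[𝓝 (π x)] id := by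
    filter_upwards [hU.mem_nhds hxU] with b hb using hπs b hb
  have h1 := mfderiv_comp (π x) (h.mdifferentiable _) hsd
  rw [e.mfderiv_eq, mfderiv_id] at h1
  have h2 := congrArg (fun L => L (X (π x))) h1
  have h3 : X (π x) = mfderiv 𝓘(ℝ, E') 𝓘(ℝ, E) π (s (π x))
    (mfderiv 𝓘(ℝ, E) 𝓘(ℝ, E') s (π x) (X (π x))) := h2
  rw [hsx] at h3
  exact ⟨_, h3.symm⟩

end Connection

end PrincipalBundle

/-! ### The local flow of a lifted vector field. -/

section LiftedField

variable {E : Type*} [NormedAddCommGroup E] [NormedSpace ℝ E]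
  {B : Type*} [TopologicalSpace B] [ChartedSpace E B]
  {E' : Type*} [NormedAddCommGroup E'] [NormedSpace ℝ E']
  {M : Type*} [TopologicalSpace M] [ChartedSpace E' M]
  {P : SmoothCircleAction E' M} {π : M → B} {α : DiffForm E' M 1}

/-- A tangent vector on a principal circle bundle is determined by its projection and by the value
of a connection form. -/
theorem IsConnectionForm.tangent_ext (hα : IsConnectionForm P α)
    (h : IsPrincipalCircleBundle (E := E) P π) {x : M} {v w : TangentSpace 𝓘(ℝ, E') x}
    (hvw : mfderiv 𝓘(ℝ, E') 𝓘(ℝ, E) π x v = mfderiv 𝓘(ℝ, E') 𝓘(ℝ, E) π x w)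
    (hαvw : α x ![v] = α x ![w]) : v = w := by
  refine sub_eq_zero.1 (hα.eq_zero_of_horizontal h ?_ ?_)
  · rw [map_sub, hvw, sub_self]
  · rw [α.apply_sub, hαvw, sub_self]

/-- A curve with velocity prescribed by its projection and by a connection form is an integral
curve. -/
theorem IsConnectionForm.hasMFDerivAt_of_projection (hα : IsConnectionForm P α)
    (h : IsPrincipalCircleBundle (E := E) P π) {γ : ℝ → M} {t : ℝ}
    (hγ : MDifferentiableAt 𝓘(ℝ, ℝ) 𝓘(ℝ, E') γ t) {w : TangentSpace 𝓘(ℝ, E') (γ t)}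
    (hπ : HasMFDerivAt 𝓘(ℝ, ℝ) 𝓘(ℝ, E) (π ∘ γ) t
      ((1 : ℝ →L[ℝ] ℝ).smulRight (mfderiv 𝓘(ℝ, E') 𝓘(ℝ, E) π (γ t) w)))
    (hw : α (γ t) ![mfderiv 𝓘(ℝ, ℝ) 𝓘(ℝ, E') γ t (1 : ℝ)] = α (γ t) ![w]) :
    HasMFDerivAt 𝓘(ℝ, ℝ) 𝓘(ℝ, E') γ t ((1 : ℝ →L[ℝ] ℝ).smulRight w) := by
  have h1 : mfderiv 𝓘(ℝ, E') 𝓘(ℝ, E) π (γ t) (mfderiv 𝓘(ℝ, ℝ) 𝓘(ℝ, E') γ t (1 : ℝ)) =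
      (1 : ℝ) • mfderiv 𝓘(ℝ, E') 𝓘(ℝ, E) π (γ t) w :=
    congrArg (fun L => L (1 : ℝ)) (hasMFDerivAt_unique
      ((h.mdifferentiable (γ t)).hasMFDerivAt.comp t hγ.hasMFDerivAt) hπ)
  rw [one_smul] at h1
  have h2 := hα.tangent_ext h h1 hw
  refine hγ.hasMFDerivAt.congr_mfderiv ?_
  ext
  have h3 : mfderiv 𝓘(ℝ, ℝ) 𝓘(ℝ, E') γ t (1 : ℝ) = (1 : ℝ) • w := by rw [h2, one_smul]
  exact h3

/-- The curve is sought as e^{iu(t)}·s(e^{it}·π(x)): it has the right projection whatever u is. By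
the gauge formula, α takes the prescribed value on its velocity exactly when u' is a known function
of `t`, so integration replaces solving a differential equation. -/
theorem hasLocalFlowAt_lift [FiniteDimensional ℝ E] [IsManifold 𝓘(ℝ, E) ∞ B]
    [IsManifold 𝓘(ℝ, E') ∞ M] (h : IsPrincipalCircleBundle (E := E) P π)
    (hα : IsConnectionForm P α) (A : SmoothCircleAction E B) {K : B → ℝ}
    (hK : ContMDiff 𝓘(ℝ, E) 𝓘(ℝ, ℝ) ∞ K) {V : ∀ x : M, TangentSpace 𝓘(ℝ, E') x}
    (hαV : ∀ x, α x ![V x] = K (π x))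
    (hπV : ∀ x, mfderiv 𝓘(ℝ, E') 𝓘(ℝ, E) π x (V x) = A.generator (π x)) (x₀ : M) :
    HasLocalFlowAt V x₀ := by
  obtain ⟨U, s, θ, hU, hxU, hs, hπs, hact, hθ, hθs⟩ := h.exists_section_angle x₀
  set φ := extChartAt 𝓘(ℝ, E) (π x₀) with hφ
  set y₀ := φ (π x₀)
  set m : ℝ × E → B := fun p => A.act (Circle.exp p.1) (φ.symm p.2)
  set σ : ℝ × E → M := fun p => s (m p)
  have hy₀ : φ.symm y₀ = π x₀ := φ.left_inv (mem_extChartAt_source _)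
  have hm0 : m (0, y₀) = π x₀ := by simp only [m, hy₀, Circle.exp_zero, A.act_one]
  have hm : ∀ᶠ p in 𝓝 ((0 : ℝ), y₀), ContMDiffAt 𝓘(ℝ, ℝ × E) 𝓘(ℝ, E) ∞ m p := by
    have : ∀ᶠ p : ℝ × E in 𝓝 (0, y₀), p.2 ∈ φ.target :=
      continuous_snd.continuousAt.eventually_mem
        (show φ.target ∈ 𝓝 y₀ from extChartAt_target_mem_nhds (π x₀))
    filter_upwards [this] with p hp
    have h1 : ContMDiffAt 𝓘(ℝ, E) 𝓘(ℝ, E) ∞ φ.symm p.2 :=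
      (contMDiffOn_extChartAt_symm (π x₀)).contMDiffAt
        ((isOpen_extChartAt_target (π x₀)).mem_nhds hp)
    have h2 : ContMDiffAt 𝓘(ℝ, ℝ × E) 𝓘(ℝ, E) ∞ (fun p : ℝ × E => φ.symm p.2) p :=
      h1.comp p contDiff_snd.contMDiff.contMDiffAt
    exact A.contMDiff_act_exp.contMDiffAt.comp p (contDiff_fst.contMDiff.contMDiffAt.prodMk h2)
  have hmU : ∀ᶠ p in 𝓝 ((0 : ℝ), y₀), m p ∈ U :=
    hm.self_of_nhds.continuousAt.eventually_mem (hU.mem_nhds (by rwa [hm0]))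
  have hσ : ∀ᶠ p in 𝓝 ((0 : ℝ), y₀), ContMDiffAt 𝓘(ℝ, ℝ × E) 𝓘(ℝ, E') ∞ σ p := by
    filter_upwards [hm, hmU] with p hp hpU using (hs _ hpU).comp p hp
  -- `q` is the required u': the prescribed α-value minus the α-value of the velocity of the section
  -- curve. The initial angle `θ x` is added separately, so `g` starts at 0.
  obtain ⟨g, hg, hg0, hgd⟩ := exists_smooth_primitive
    (q := fun p => K (m p) - α.pullbackVec σ p ![((1 : ℝ), (0 : E))]) (y₀ := y₀) (by
      filter_upwards [hm, hσ] with p hp hσp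
      exact (hK.contMDiffAt.comp p hp).contDiffAt.sub (hα.smooth.contDiffAt_pullbackVec hσp _))
  have hcπ : ContinuousAt (fun p : ℝ × M => (p.1, φ (π p.2))) (0, x₀) := by
    refine continuousAt_fst.prodMk ?_
    exact ContinuousAt.comp (g := φ) (continuousAt_extChartAt _)
      (h.smooth.continuous.continuousAt.comp continuousAt_snd)
  have hev : ∀ᶠ p : ℝ × M in 𝓝 (0, x₀), π p.2 ∈ φ.source ∧
      m (p.1, φ (π p.2)) ∈ U ∧ ContMDiffAt 𝓘(ℝ, ℝ × E) 𝓘(ℝ, E') ∞ σ (p.1, φ (π p.2)) ∧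
      HasDerivAt (fun t => g (t, φ (π p.2))) (K (m (p.1, φ (π p.2))) -
        α.pullbackVec σ (p.1, φ (π p.2)) ![((1 : ℝ), (0 : E))]) p.1 ∧
      ContMDiffAt 𝓘(ℝ, E') 𝓘(ℝ, ℝ) ∞ θ p.2 := by
    have h1 : ∀ᶠ p : ℝ × M in 𝓝 (0, x₀), π p.2 ∈ φ.source :=
      (h.smooth.continuous.comp continuous_snd).continuousAt.eventually_mem
        (extChartAt_source_mem_nhds _)
    filter_upwards [h1, hcπ.eventually hmU, hcπ.eventually hσ, hcπ.eventually hgd,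
      continuousAt_snd.eventually hθs] with p p1 p2 p3 p4 p5 using ⟨p1, p2, p3, p4, p5⟩
  -- A product neighbourhood gives one time interval valid for all nearby starting points.
  rw [nhds_prod_eq, eventually_prod_iff] at hev
  obtain ⟨pt, hpt, px, hpx, hev⟩ := hev
  obtain ⟨ε, hε, hball⟩ := Metric.eventually_nhds_iff_ball.1 hpt
  rw [Real.ball_eq_Ioo, zero_sub, zero_add] at hball
  have hmφ : ∀ {x : M}, π x ∈ φ.source → ∀ t, m (t, φ (π x)) = A.act (Circle.exp t) (π x) :=
    fun hx t => by simp only [m, φ.left_inv hx]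
  refine ⟨fun t x => P.act (Circle.exp (g (t, φ (π x)) + θ x)) (s (A.act (Circle.exp t) (π x))),
    ε, hε, {x | px x}, hpx, ?_, ?_, ?_⟩
  · intro t ht x hx
    obtain ⟨hxφ, hmx, -, -, hθx⟩ := hev (hball t ht) hx
    rw [hmφ hxφ] at hmx
    have hπ2 : ContMDiffAt (𝓘(ℝ, ℝ).prod 𝓘(ℝ, E')) 𝓘(ℝ, E) ∞ (fun p : ℝ × M => π p.2) (t, x) :=
      h.smooth.contMDiffAt.comp (t, x) contMDiffAt_snd
    have h1 : ContMDiffAt (𝓘(ℝ, ℝ).prod 𝓘(ℝ, E')) 𝓘(ℝ, E) ∞ (fun p : ℝ × M => φ (π p.2)) (t, x) :=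
      ContMDiffAt.comp (g := φ) (t, x) (contMDiffAt_extChartAt' (by rwa [← extChartAt_source 𝓘(ℝ, E)]))
        hπ2
    have h2 : ContMDiffAt (𝓘(ℝ, ℝ).prod 𝓘(ℝ, E')) 𝓘(ℝ, ℝ) ∞
        (fun p : ℝ × M => g (p.1, φ (π p.2))) (t, x) :=
      hg.contMDiff.contMDiffAt.comp (t, x) (contMDiffAt_fst.prodMk_space h1)
    have h3 : ContMDiffAt (𝓘(ℝ, ℝ).prod 𝓘(ℝ, E')) 𝓘(ℝ, ℝ) ∞
        (fun p : ℝ × M => g (p.1, φ (π p.2)) + θ p.2) (t, x) :=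
      h2.add (hθx.comp (t, x) contMDiffAt_snd)
    have h4 : ContMDiffAt (𝓘(ℝ, ℝ).prod 𝓘(ℝ, E')) 𝓘(ℝ, E') ∞
        (fun p : ℝ × M => s (A.act (Circle.exp p.1) (π p.2))) (t, x) :=
      (hs _ hmx).comp (t, x) (A.contMDiff_act_exp.contMDiffAt.comp (t, x)
        (contMDiffAt_fst.prodMk hπ2))
    exact P.contMDiff_act_exp.contMDiffAt.comp (t, x) (h3.prodMk h4)
  · intro x hx
    obtain ⟨hxφ, hmx, -⟩ := hev (hball 0 (by simp [hε])) hx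
    rw [hmφ hxφ] at hmx
    simp only [Circle.exp_zero, A.act_one] at hmx
    simp only [hg0, Circle.exp_zero, A.act_one, zero_add]
    exact hact x hmx
  · intro x hx t ht
    obtain ⟨hxφ, hmx, hσx, hgx, -⟩ := hev (hball t ht) hx
    have hmx' : A.act (Circle.exp t) (π x) ∈ U := by rwa [hmφ hxφ] at hmx
    refine HasMFDerivAt.hasMFDerivWithinAt ?_
    have hu : HasMFDerivAt 𝓘(ℝ, ℝ) 𝓘(ℝ, ℝ) (fun t => g (t, φ (π x)) + θ x) t _ :=
      (hgx.add_const (θ x)).hasFDerivAt.hasMFDerivAt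
    have hk : MDifferentiableAt 𝓘(ℝ, ℝ) 𝓘(ℝ, E') (fun t => s (A.act (Circle.exp t) (π x))) t :=
      ((hs _ hmx').mdifferentiableAt (by simp)).comp t
        (A.hasMFDerivAt_orbit (π x) t).mdifferentiableAt
    have hπG : ∀ᶠ r in 𝓝 t, π (P.act (Circle.exp (g (r, φ (π x)) + θ x))
        (s (A.act (Circle.exp r) (π x)))) = A.act (Circle.exp r) (π x) := by
      filter_upwards [(A.hasMFDerivAt_orbit (π x) t).continuousAt.eventually_mem
        (hU.mem_nhds hmx')] with r hr
      rw [h.invariant, hπs _ hr]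
    refine hα.hasMFDerivAt_of_projection h
      (P.mdifferentiableAt_act_exp hu.mdifferentiableAt hk) ?_ ?_
    · have := (A.hasMFDerivAt_orbit (π x) t).congr_of_eventuallyEq hπG
      rw [hπV, hπG.self_of_nhds]
      exact this
    · have key := hα.apply_mfderiv_act_exp hu.mdifferentiableAt hk (1 : ℝ)
      refine key.trans ?_
      rw [hαV, hπG.self_of_nhds]
      have h1 : mvfderiv 𝓘(ℝ, ℝ) (fun t => g (t, φ (π x)) + θ x) t (1 : ℝ) =
          K (m (t, φ (π x))) - α.pullbackVec σ (t, φ (π x)) ![((1 : ℝ), (0 : E))] :=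
        (congrArg (fun L => L (1 : ℝ)) hu.mfderiv).trans (one_smul ℝ _)
      have h2 : α ((fun t => s (A.act (Circle.exp t) (π x))) t)
          ![mfderiv 𝓘(ℝ, ℝ) 𝓘(ℝ, E') (fun t => s (A.act (Circle.exp t) (π x))) t (1 : ℝ)] =
          α.pullbackVec σ (t, φ (π x)) ![((1 : ℝ), (0 : E))] := by
        have e : (fun t => s (A.act (Circle.exp t) (π x))) = fun t => σ (t, φ (π x)) :=
          funext fun t => by simp only [σ, hmφ hxφ]
        rw [e, DiffForm.pullbackVec_apply]
        refine congrArg (α (σ (t, φ (π x))) : (Fin 1 → E') → ℝ) (funext fun i => ?_)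
        fin_cases i
        have hι : HasFDerivAt (fun t : ℝ => (t, φ (π x))) (ContinuousLinearMap.inl ℝ ℝ E) t :=
          hasFDerivAt_prodMk_left t _
        exact congrArg (fun L => L (1 : ℝ)) ((hσx.mdifferentiableAt
          (by simp)).hasMFDerivAt.comp (f := fun t : ℝ => (t, φ (π x))) t hι.hasMFDerivAt).mfderiv
      refine (congrArg₂ (fun a b : ℝ => a + b) h1 h2).trans ?_
      rw [← hmφ hxφ t]
      exact sub_add_cancel (K (m (t, φ (π x)))) _

end LiftedField

/-! ### Functions with vanishing differential. -/

section Functions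

variable {E : Type*} [NormedAddCommGroup E] [NormedSpace ℝ E]
  {N : Type*} [TopologicalSpace N] [ChartedSpace E N]

theorem mvfderiv_eq_zero_of_isLocalMin {f : N → ℝ} {x : N} (hf : IsLocalMin f x)
    (hd : MDifferentiableAt 𝓘(ℝ, E) 𝓘(ℝ, ℝ) f x) (v : TangentSpace 𝓘(ℝ, E) x) :
    mvfderiv 𝓘(ℝ, E) f x v = 0 := by
  have hmin : IsLocalMin (f ∘ (extChartAt 𝓘(ℝ, E) x).symm) (extChartAt 𝓘(ℝ, E) x x) := by
    have hc : Tendsto (extChartAt 𝓘(ℝ, E) x).symm (𝓝 (extChartAt 𝓘(ℝ, E) x x)) (𝓝 x) := by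
      have := (continuousAt_extChartAt_symm (I := 𝓘(ℝ, E)) x).tendsto
      rwa [extChartAt_to_inv] at this
    have := hc.eventually hf
    unfold IsLocalMin IsMinFilter
    simpa only [Function.comp, extChartAt_to_inv] using this
  have h1 := hd.mfderiv
  rw [modelWithCornersSelf_coe, range_id, fderivWithin_univ] at h1
  have h2 : fderiv ℝ (f ∘ (extChartAt 𝓘(ℝ, E) x).symm) (extChartAt 𝓘(ℝ, E) x x) = 0 :=
    hmin.fderiv_eq_zero
  have h3 : mfderiv 𝓘(ℝ, E) 𝓘(ℝ, ℝ) f x = 0 := h1.trans h2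
  change mfderiv 𝓘(ℝ, E) 𝓘(ℝ, ℝ) f x v = 0
  rw [h3]
  rfl

theorem eventually_eq_of_mvfderiv_eq_zero [IsManifold 𝓘(ℝ, E) ∞ N] {f : N → ℝ} {x : N}
    (hf : ∀ᶠ y in 𝓝 x, MDifferentiableAt 𝓘(ℝ, E) 𝓘(ℝ, ℝ) f y ∧
      ∀ v : TangentSpace 𝓘(ℝ, E) y, mvfderiv 𝓘(ℝ, E) f y v = 0) :
    ∀ᶠ y in 𝓝 x, f y = f x := by
  set φ := extChartAt 𝓘(ℝ, E) x
  have hc : Tendsto φ.symm (𝓝 (φ x)) (𝓝 x) := by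
    have := (continuousAt_extChartAt_symm (I := 𝓘(ℝ, E)) x).tendsto
    rwa [extChartAt_to_inv] at this
  have hz : ∀ᶠ z in 𝓝 (φ x), HasFDerivAt (f ∘ φ.symm) (0 : E →L[ℝ] ℝ) z := by
    filter_upwards [hc.eventually hf, extChartAt_target_mem_nhds (I := 𝓘(ℝ, E)) x] with z hz hzt
    have hsymm : MDifferentiableAt 𝓘(ℝ, E) 𝓘(ℝ, E) φ.symm z := by
      have := mdifferentiableWithinAt_extChartAt_symm (I := 𝓘(ℝ, E)) hzt
      rwa [modelWithCornersSelf_coe, range_id, mdifferentiableWithinAt_univ] at this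
    have h0 : mfderiv 𝓘(ℝ, E) 𝓘(ℝ, ℝ) f (φ.symm z) = 0 := ContinuousLinearMap.ext hz.2
    have h1 := hz.1.hasMFDerivAt.comp z hsymm.hasMFDerivAt
    rw [h0, ContinuousLinearMap.zero_comp] at h1
    exact h1.hasFDerivAt
  obtain ⟨ε, hε, hball⟩ := Metric.eventually_nhds_iff_ball.1 hz
  have hcφ : ∀ᶠ y in 𝓝 x, φ y ∈ Metric.ball (φ x) ε :=
    (continuousAt_extChartAt x).eventually_mem (Metric.ball_mem_nhds _ hε)
  filter_upwards [hcφ, extChartAt_source_mem_nhds (I := 𝓘(ℝ, E)) x] with y hy hys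
  have := (convex_ball (φ x) ε).is_const_of_fderivWithin_eq_zero (𝕜 := ℝ) (f := f ∘ φ.symm)
    (fun z hz => (hball z hz).differentiableAt.differentiableWithinAt)
    (fun z hz => by
      rw [fderivWithin_of_isOpen Metric.isOpen_ball hz, (hball z hz).fderiv])
    hy (Metric.mem_ball_self hε)
  simpa only [Function.comp, φ.left_inv hys, φ, extChartAt_to_inv] using this

end Functions

/-! ### Invariance of α under the flow. -/

section ContactFlow

variable {E : Type*} [NormedAddCommGroup E] [NormedSpace ℝ E]
  {N : Type*} [TopologicalSpace N] [ChartedSpace E N] [IsManifold 𝓘(ℝ, E) ∞ N]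

/-- The flow of a vector field `V` with `d(α(V)) + dα(V, ·) = 0` preserves the 1-form `α`. -/
theorem DiffForm.IsSmooth.apply_mfderiv_flow {α : DiffForm E N 1} (hα : α.IsSmooth) {K : N → ℝ}
    (hK : ContMDiff 𝓘(ℝ, E) 𝓘(ℝ, ℝ) ∞ K) {V : ∀ x : N, TangentSpace 𝓘(ℝ, E) x}
    (hαV : ∀ x, α x ![V x] = K x)
    (hdαV : ∀ (x : N) (v : TangentSpace 𝓘(ℝ, E) x), α.d x ![V x, v] = -mvfderiv 𝓘(ℝ, E) K x v)
    {F : ℝ → N → N} (hF : ContMDiff (𝓘(ℝ, ℝ).prod 𝓘(ℝ, E)) 𝓘(ℝ, E) ∞ (Function.uncurry F))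
    (hF0 : ∀ x, F 0 x = x) (hFV : ∀ x, IsMIntegralCurve (fun t => F t x) V) (t : ℝ) (x : N)
    (v : TangentSpace 𝓘(ℝ, E) x) :
    α (F t x) ![mfderiv 𝓘(ℝ, E) 𝓘(ℝ, E) (F t) x v] = α x ![v] := by
  set φ := extChartAt 𝓘(ℝ, E) x
  set σ : ℝ × E → N := fun p => F p.1 (φ.symm p.2)
  set w : E := mfderiv 𝓘(ℝ, E) 𝓘(ℝ, E) φ x v
  have hσ : ∀ p : ℝ × E, p.2 ∈ φ.target → ContMDiffAt 𝓘(ℝ, ℝ × E) 𝓘(ℝ, E) ∞ σ p := by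
    intro p hp
    have h1 : ContMDiffAt 𝓘(ℝ, E) 𝓘(ℝ, E) ∞ φ.symm p.2 :=
      (contMDiffOn_extChartAt_symm x).contMDiffAt ((isOpen_extChartAt_target x).mem_nhds hp)
    have h2 : ContMDiffAt 𝓘(ℝ, ℝ × E) 𝓘(ℝ, E) ∞ (fun p : ℝ × E => φ.symm p.2) p :=
      h1.comp p contDiff_snd.contMDiff.contMDiffAt
    exact hF.contMDiffAt.comp p (contDiff_fst.contMDiff.contMDiffAt.prodMk h2)
  have hφx : φ x ∈ φ.target := mem_extChartAt_target x
  have hev : ∀ t : ℝ, ∀ᶠ p : ℝ × E in 𝓝 (t, φ x), p.2 ∈ φ.target := fun t =>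
    continuous_snd.continuousAt.eventually_mem
      (show φ.target ∈ 𝓝 (φ x) from extChartAt_target_mem_nhds x)
  have hu : ∀ p : ℝ × E, p.2 ∈ φ.target →
      mfderiv 𝓘(ℝ, ℝ × E) 𝓘(ℝ, E) σ p ((1 : ℝ), (0 : E)) = V (σ p) := by
    intro p hp
    have hι : HasFDerivAt (fun t : ℝ => (t, p.2)) (ContinuousLinearMap.inl ℝ ℝ E) p.1 :=
      hasFDerivAt_prodMk_left p.1 _
    have h1 := ((hσ p hp).mdifferentiableAt (by simp)).hasMFDerivAt.comp
      (f := fun t : ℝ => (t, p.2)) p.1 hι.hasMFDerivAt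
    have h2 : mfderiv 𝓘(ℝ, ℝ × E) 𝓘(ℝ, E) σ p ((1 : ℝ), (0 : E)) = (1 : ℝ) • V (σ p) :=
      congrArg (fun L => L (1 : ℝ)) (hasMFDerivAt_unique h1 (hFV (φ.symm p.2) p.1))
    rwa [one_smul] at h2
  have hpu : ∀ p : ℝ × E, p.2 ∈ φ.target →
      α.pullbackVec σ p ![((1 : ℝ), (0 : E))] = K (σ p) := by
    intro p hp
    rw [← hαV, ← hu p hp, DiffForm.pullbackVec_apply]
    refine congrArg (α (σ p) : (Fin 1 → E) → ℝ) (funext fun i => ?_)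
    fin_cases i
    rfl
  -- `r t` is (F_t^*α)(v). Evaluating dα on the coordinate directions ∂_t and `w` gives r' = dα(V,
  -- σ_*w) + ∂_w(K∘σ), which vanishes by `hdαV`.
  set r : ℝ → ℝ := fun t => α.pullbackVec σ (t, φ x) ![((0 : ℝ), w)]
  have hr : ∀ t, HasDerivAt r 0 t := by
    intro t
    have hd := hα.d_apply_mfderiv (hσ (t, φ x) hφx) ((1 : ℝ), (0 : E)) ((0 : ℝ), w)
    have hKσ : fderiv ℝ (fun z => α.pullbackVec σ z ![((1 : ℝ), (0 : E))]) (t, φ x) ((0 : ℝ), w) =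
        mvfderiv 𝓘(ℝ, E) K (σ (t, φ x)) (mfderiv 𝓘(ℝ, ℝ × E) 𝓘(ℝ, E) σ (t, φ x) ((0 : ℝ), w)) := by
      have e : (fun z => α.pullbackVec σ z ![((1 : ℝ), (0 : E))]) =ᶠ[𝓝 (t, φ x)] K ∘ σ := by
        filter_upwards [hev t] with p hp using hpu p hp
      rw [e.fderiv_eq, ← mfderiv_eq_fderiv]
      exact congrArg (fun L => L ((0 : ℝ), w)) (mfderiv_comp (t, φ x)
        (hK.contMDiffAt.mdifferentiableAt (by simp))
        ((hσ (t, φ x) hφx).mdifferentiableAt (by simp)))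
    rw [hu _ hφx, hdαV, hKσ] at hd
    have h0 : fderiv ℝ (fun z => α.pullbackVec σ z ![((0 : ℝ), w)]) (t, φ x)
        ((1 : ℝ), (0 : E)) = 0 := by linarith
    have hι : HasFDerivAt (fun t : ℝ => (t, φ x)) (ContinuousLinearMap.inl ℝ ℝ E) t :=
      hasFDerivAt_prodMk_left t _
    have h1 := (((hα.contDiffAt_pullbackVec (hσ (t, φ x) hφx) ((0 : ℝ), w)).differentiableAt
      (by simp)).hasFDerivAt.comp (f := fun t : ℝ => (t, φ x)) t hι).hasDerivAt
    have h2 : HasDerivAt r (fderiv ℝ (fun z => α.pullbackVec σ z ![((0 : ℝ), w)]) (t, φ x)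
        ((1 : ℝ), (0 : E))) t := h1
    rwa [h0] at h2
  have hrt : ∀ t, r t = α (F t x) ![mfderiv 𝓘(ℝ, E) 𝓘(ℝ, E) (F t) x v] := by
    intro t
    have hι : HasFDerivAt (fun y : E => (t, y)) (ContinuousLinearMap.inr ℝ ℝ E) (φ x) :=
      hasFDerivAt_prodMk_right t _
    have hφd : MDifferentiableAt 𝓘(ℝ, E) 𝓘(ℝ, E) φ x :=
      mdifferentiableAt_extChartAt (mem_chart_source _ _)
    have h1 := (((hσ (t, φ x) hφx).mdifferentiableAt (by simp)).hasMFDerivAt.comp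
      (f := fun y : E => (t, y)) (φ x) hι.hasMFDerivAt).comp x hφd.hasMFDerivAt
    have e : F t =ᶠ[𝓝 x] (σ ∘ fun y : E => (t, y)) ∘ φ := by
      filter_upwards [extChartAt_source_mem_nhds (I := 𝓘(ℝ, E)) x] with y hy
      simp only [Function.comp, σ, φ, (extChartAt 𝓘(ℝ, E) x).left_inv hy]
    have h2 := (h1.congr_of_eventuallyEq e).mfderiv
    have h3 : mfderiv 𝓘(ℝ, E) 𝓘(ℝ, E) (F t) x v =
        mfderiv 𝓘(ℝ, ℝ × E) 𝓘(ℝ, E) σ (t, φ x) ((0 : ℝ), w) := congrArg (fun L => L v) h2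
    have h4 : σ (t, φ x) = F t x := by simp only [σ, φ, extChartAt_to_inv]
    simp only [r]
    rw [DiffForm.pullbackVec_apply, h3, ← h4]
    refine congrArg (α (σ (t, φ x)) : (Fin 1 → E) → ℝ) (funext fun i => ?_)
    fin_cases i
    rfl
  have hconst : r t = r 0 := is_const_of_deriv_eq_zero (fun t => (hr t).differentiableAt)
    (fun t => (hr t).deriv) t 0
  rw [← hrt t, hconst, hrt 0]
  have e0 : F 0 = id := funext hF0
  rw [e0, mfderiv_id]
  rfl

end ContactFlow

/-! ### Rigidity of gauge transformations preserving α. -/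

section Gauge

variable {E : Type*} [NormedAddCommGroup E] [NormedSpace ℝ E]
  {B : Type*} [TopologicalSpace B] [ChartedSpace E B]
  {E' : Type*} [NormedAddCommGroup E'] [NormedSpace ℝ E']
  {M : Type*} [TopologicalSpace M] [ChartedSpace E' M]
  {P : SmoothCircleAction E' M} {π : M → B} {α : DiffForm E' M 1}

theorem IsPrincipalCircleBundle.exists_act_eq (h : IsPrincipalCircleBundle (E := E) P π) {x y : M}
    (hxy : π x = π y) : ∃ g, P.act g y = x := by
  obtain ⟨U, s, θ, -, hyU, -, -, hact, -⟩ := h.exists_section_angle y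
  have hx := hact x (by rwa [hxy])
  have hy := hact y hyU
  rw [hxy] at hx
  refine ⟨Circle.exp (θ x) * (Circle.exp (θ y))⁻¹, (congrArg (P.act _) hy.symm).trans ?_⟩
  rw [← P.act_mul, inv_mul_cancel_right, hx]

variable [IsManifold 𝓘(ℝ, E') ∞ M]

/-- A gauge transformation preserving a connection form is the identity near each fixed point. -/
theorem IsConnectionForm.eventually_fixed (hα : IsConnectionForm P α)
    (h : IsPrincipalCircleBundle (E := E) P π) {T : M → M}
    (hT : ContMDiff 𝓘(ℝ, E') 𝓘(ℝ, E') ∞ T) (hπT : ∀ x, π (T x) = π x)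
    (hαT : ∀ (x : M) (v : TangentSpace 𝓘(ℝ, E') x),
      α (T x) ![mfderiv 𝓘(ℝ, E') 𝓘(ℝ, E') T x v] = α x ![v]) {x₀ : M} (hx₀ : T x₀ = x₀) :
    ∀ᶠ x in 𝓝 x₀, T x = x := by
  obtain ⟨U, s, θ, hU, hxU, -, -, hact, -, hθ⟩ := h.exists_section_angle x₀
  have hπU : ∀ᶠ x in 𝓝 x₀, π x ∈ U :=
    h.smooth.continuous.continuousAt.eventually_mem (hU.mem_nhds hxU)
  have hTx : ∀ x, π x ∈ U → P.act (Circle.exp (θ (T x) - θ x)) x = T x := by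
    intro x hx
    have h1 := hact x hx
    have h2 := hact (T x) (by rwa [hπT])
    rw [hπT] at h2
    refine (congrArg (P.act _) h1.symm).trans ?_
    rw [← P.act_mul, ← Circle.exp_add, sub_add_cancel, h2]
  have hθT : ∀ᶠ x in 𝓝 x₀, ContMDiffAt 𝓘(ℝ, E') 𝓘(ℝ, ℝ) ∞ θ (T x) := by
    have := hT.continuous.continuousAt (x := x₀)
    rw [ContinuousAt, hx₀] at this
    exact this.eventually hθ
  have hκ : ∀ᶠ x in 𝓝 x₀, θ (T x) - θ x = θ (T x₀) - θ x₀ := by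
    refine eventually_eq_of_mvfderiv_eq_zero (E := E') (f := fun x => θ (T x) - θ x) ?_
    filter_upwards [hθ, hθT, hπU.eventually_nhds] with x hx hTθ hxU
    have hd : MDifferentiableAt 𝓘(ℝ, E') 𝓘(ℝ, ℝ) (fun x => θ (T x) - θ x) x :=
      ((hTθ.comp x hT.contMDiffAt).sub hx).mdifferentiableAt (by simp)
    refine ⟨hd, fun v => ?_⟩
    -- With κ = θ∘T - θ, this reads α(T_*v) = dκ(v) + α(v); invariance of α forces dκ = 0.
    have key := hα.apply_mfderiv_act_exp (k := fun x => x) hd mdifferentiableAt_id v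
    have e : (fun x => P.act (Circle.exp (θ (T x) - θ x)) x) =ᶠ[𝓝 x] T := by
      filter_upwards [hxU] with y hy using hTx y hy
    have hid : mfderiv 𝓘(ℝ, E') 𝓘(ℝ, E') (fun x : M => x) x v = v := by
      rw [show (fun x : M => x) = id from rfl, mfderiv_id]
      rfl
    rw [e.mfderiv_eq, hTx x hxU.self_of_nhds, hαT, hid] at key
    linarith
  filter_upwards [hκ, hπU] with x hx hxU
  rw [hx₀, sub_self] at hx
  rw [← hTx x hxU, hx, Circle.exp_zero, P.act_one]

/-- A gauge transformation preserving a connection form and having a fixed point is the identity. -/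
theorem IsConnectionForm.gauge_eq_self [T2Space M] [PreconnectedSpace B]
    (hα : IsConnectionForm P α)
    (h : IsPrincipalCircleBundle (E := E) P π) {T : M → M}
    (hT : ContMDiff 𝓘(ℝ, E') 𝓘(ℝ, E') ∞ T) (hπT : ∀ x, π (T x) = π x)
    (hαT : ∀ (x : M) (v : TangentSpace 𝓘(ℝ, E') x),
      α (T x) ![mfderiv 𝓘(ℝ, E') 𝓘(ℝ, E') T x v] = α x ![v])
    (hTP : ∀ g x, T (P.act g x) = P.act g (T x)) {x₀ : M} (hx₀ : T x₀ = x₀) (x : M) :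
    T x = x := by
  set D : Set M := {x | T x = x}
  have hDP : ∀ {x y}, π x = π y → y ∈ D → x ∈ D := by
    intro x y hxy hy
    obtain ⟨g, rfl⟩ := h.exists_act_eq hxy
    exact (hTP g y).trans (congrArg (P.act g) hy)
  have hDopen : IsOpen D := isOpen_iff_mem_nhds.2 fun y hy => hα.eventually_fixed h hT hπT hαT hy
  have hDclosed : IsClosed D := isClosed_eq hT.continuous continuous_id
  -- The fixed set is a union of fibres, so its image and that of its complement are disjoint. Both
  -- are open, and connectedness is needed only on B.
  have hcompl : (π '' D)ᶜ = π '' Dᶜ := by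
    ext b
    constructor
    · intro hb
      obtain ⟨y, rfl⟩ := h.surjective b
      exact ⟨y, fun hy => hb ⟨y, hy, rfl⟩, rfl⟩
    · rintro ⟨y, hy, rfl⟩ ⟨z, hz, hzy⟩
      exact hy (hDP hzy.symm hz)
  have hclopen : IsClopen (π '' D) :=
    ⟨isOpen_compl_iff.1 (hcompl ▸ h.isOpenMap _ hDclosed.isOpen_compl), h.isOpenMap _ hDopen⟩
  have huniv : π '' D = univ := hclopen.eq_univ ⟨_, x₀, hx₀, rfl⟩
  obtain ⟨y, hy, hyx⟩ := huniv.symm ▸ mem_univ (π x)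
  exact hDP hyx.symm hy

end Gauge

/-! ### From a 2π-periodic flow to a circle action. -/

section PeriodicFlow

variable {E : Type*} [NormedAddCommGroup E] [NormedSpace ℝ E]
  {N : Type*} [TopologicalSpace N] [ChartedSpace E N]

theorem exists_circleAction_of_periodic_flow {F : ℝ → N → N}
    (hF : ContMDiff (𝓘(ℝ, ℝ).prod 𝓘(ℝ, E)) 𝓘(ℝ, E) ∞ (Function.uncurry F))
    (hF0 : ∀ x, F 0 x = x) (hFadd : ∀ s t x, F (s + t) x = F s (F t x))
    (hper : ∀ x, F (2 * Real.pi) x = x) :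
    ∃ L : SmoothCircleAction E N, ∀ t x, L.act (Circle.exp t) x = F t x := by
  have hp : ∀ x, Function.Periodic (fun t => F t x) (2 * Real.pi) := fun x t => by
    simp only [hFadd, hper]
  have hexp : ∀ {s t : ℝ} (x : N), Circle.exp s = Circle.exp t → F s x = F t x := by
    intro s t x hst
    obtain ⟨m, rfl⟩ := Circle.exp_eq_exp.1 hst
    exact (hp x).int_mul m t
  let L : MulAction Circle N :=
    { smul := fun g x => F (Complex.arg g) x
      one_smul := fun x => by
        change F (Complex.arg (1 : Circle)) x = x
        simp [hF0]
      mul_smul := fun g h x => by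
        change F (Complex.arg (g * h : Circle)) x = F (Complex.arg g) (F (Complex.arg h) x)
        rw [← hFadd]
        refine hexp x ?_
        rw [Circle.exp_add, Circle.exp_arg, Circle.exp_arg, Circle.exp_arg] }
  refine ⟨{ toMulAction := L, contMDiffSMul := ⟨?_⟩ }, fun t x => hexp x (Circle.exp_arg _)⟩
  rintro ⟨g₀, x₀⟩
  -- Periodicity allows any choice of angle; measuring it from `g₀` keeps the branch cut of the
  -- argument away from `g₀`.
  have e : (fun p : Circle × N => p.1 • p.2) =
      fun p => F ((fun z : Circle => Complex.arg z) (p.1 * g₀⁻¹) + Complex.arg g₀) p.2 := by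
    funext p
    refine hexp p.2 ?_
    rw [Circle.exp_add]
    refine (Circle.exp_arg p.1).trans ?_
    rw [Circle.exp_arg, Circle.exp_arg, inv_mul_cancel_right]
  rw [e]
  have h1 : ContMDiffAt ((𝓡 1).prod 𝓘(ℝ, E)) (𝓡 1) ∞ (fun p : Circle × N => p.1 * g₀⁻¹)
      (g₀, x₀) := (contMDiff_circle_mul_right g₀⁻¹).contMDiffAt.comp (g₀, x₀) contMDiffAt_fst
  have h2 := eventually_contMDiffAt_circle_arg.self_of_nhds
  rw [← mul_inv_cancel g₀] at h2
  have h3 : ContMDiffAt ((𝓡 1).prod 𝓘(ℝ, E)) 𝓘(ℝ, ℝ) ∞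
      (fun p : Circle × N => (fun z : Circle => Complex.arg z) (p.1 * g₀⁻¹)) (g₀, x₀) :=
    ContMDiffAt.comp (g := fun z : Circle => Complex.arg z) (g₀, x₀) h2 h1
  exact hF.contMDiffAt.comp (g₀, x₀)
    ((h3.add (contMDiffAt_const (c := Complex.arg g₀))).prodMk contMDiffAt_snd)

end PeriodicFlow

/-! ### Zeros of X, normalisation of H, and the lifted action. -/

section Lift

variable {E : Type*} [NormedAddCommGroup E] [NormedSpace ℝ E]
  {B : Type*} [TopologicalSpace B] [ChartedSpace E B]
  {E' : Type*} [NormedAddCommGroup E'] [NormedSpace ℝ E']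
  {M : Type*} [TopologicalSpace M] [ChartedSpace E' M]
  {P : SmoothCircleAction E' M} {π : M → B} {α : DiffForm E' M 1} {Ω : DiffForm E B 2}

theorem IsBoothbyWangBundle.d_apply (hM : IsBoothbyWangBundle Ω P π α) (x : M)
    (v w : TangentSpace 𝓘(ℝ, E') x) :
    α.d x ![v, w] = Ω (π x) ![mfderiv 𝓘(ℝ, E') 𝓘(ℝ, E) π x v, mfderiv 𝓘(ℝ, E') 𝓘(ℝ, E) π x w] := by
  rw [hM.curvature]
  refine congrArg (Ω (π x) : (Fin 2 → E) → ℝ) (funext fun i => ?_)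
  fin_cases i <;> rfl

theorem IsBoothbyWangBundle.isReebField_generator (hM : IsBoothbyWangBundle Ω P π α) :
    IsReebField α P.generator := by
  refine fun x => ⟨hM.connection.normalized x, fun v => ?_⟩
  rw [hM.d_apply, hM.principal.mfderiv_generator]
  exact (Ω (π x)).map_coord_zero 0 rfl

theorem mvfderiv_comp_projection_add_const {H : B → ℝ} (hπ : MDifferentiable 𝓘(ℝ, E') 𝓘(ℝ, E) π)
    (hH : MDifferentiable 𝓘(ℝ, E) 𝓘(ℝ, ℝ) H) (c : ℝ) (x : M) (v : TangentSpace 𝓘(ℝ, E') x) :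
    mvfderiv 𝓘(ℝ, E') (fun x => H (π x) + c) x v =
      mvfderiv 𝓘(ℝ, E) H (π x) (mfderiv 𝓘(ℝ, E') 𝓘(ℝ, E) π x v) := by
  have h1 : MDifferentiableAt 𝓘(ℝ, E') 𝓘(ℝ, ℝ) (fun x => H (π x)) x := (hH (π x)).comp x (hπ x)
  rw [mvfderiv_fun_add h1 mdifferentiableAt_const, mvfderiv_const, add_zero]
  exact congrArg (fun L => L v) (mfderiv_comp x (hH (π x)) (hπ x))

theorem IsHamiltonianAction.exists_generator_eq_zero [CompactSpace B] [Nonempty B]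
    (hΩ : IsSymplectic Ω) {A : SmoothCircleAction E B} {H : B → ℝ}
    (hA : IsHamiltonianAction Ω A H) : ∃ p : B, A.generator p = 0 := by
  obtain ⟨p, -, hp⟩ := isCompact_univ.exists_isMinOn univ_nonempty
    hA.smooth.continuous.continuousOn
  refine ⟨p, hΩ.nondegenerate p _ fun v => ?_⟩
  rw [hA.hamiltonian, mvfderiv_eq_zero_of_isLocalMin (hp.isLocalMin univ_mem)
    (hA.smooth.mdifferentiable (by simp) p), neg_zero]

theorem exists_add_const_pos_natCast [CompactSpace B] {H : B → ℝ} (hH : Continuous H) (p₀ : B) :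
    ∃ c : ℝ, (∀ b, 0 < H b + c) ∧ ∃ n : ℕ, H p₀ + c = n := by
  obtain ⟨C, hC⟩ := (isCompact_range hH).bddBelow
  obtain ⟨n, hn⟩ := exists_nat_gt (H p₀ - C)
  -- `C` bounds H below, so `H b + c ≥ C + n - H p₀ > 0`.
  refine ⟨n - H p₀, fun b => ?_, n, by ring⟩
  have := hC (mem_range_self b)
  linarith

variable [FiniteDimensional ℝ E] [IsManifold 𝓘(ℝ, E) ∞ B] [T2Space B] [CompactSpace B]
  [PreconnectedSpace B] [FiniteDimensional ℝ E'] [IsManifold 𝓘(ℝ, E') ∞ M] [T2Space M]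

theorem IsBoothbyWangBundle.exists_lift (hM : IsBoothbyWangBundle Ω P π α)
    {A : SmoothCircleAction E B} {H : B → ℝ} (hA : IsHamiltonianAction Ω A H)
    {Xh : ∀ x : M, TangentSpace 𝓘(ℝ, E') x} (hXh : IsHorizontalLift π α A.generator Xh)
    {p₀ : B} {c : ℝ} (hp₀ : A.generator p₀ = 0) (hc : ∃ m : ℤ, H p₀ + c = m) :
    (∀ p : B, A.generator p = 0 → ∃ m : ℤ, H p + c = m) ∧
      ∃ L : SmoothCircleAction E' M,
        (∀ (g : Circle) (x : M), π (L.act g x) = A.act g (π x)) ∧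
        (∀ g : Circle, α.pullback (L.act g) = α) ∧
        (∀ x : M, L.generator x = (H (π x) + c) • P.generator x + Xh x) ∧
        IsContactHamiltonianField α P.generator (fun x => H (π x) + c) L.generator := by
  have hP := hM.principal
  have hα := hM.connection
  have : CompactSpace M := hP.compactSpace
  have : CompleteSpace E := FiniteDimensional.complete ℝ E
  have : CompleteSpace E' := FiniteDimensional.complete ℝ E'
  set V : ∀ x : M, TangentSpace 𝓘(ℝ, E') x := fun x => (H (π x) + c) • P.generator x + Xh x
  have hαV : ∀ x, α x ![V x] = H (π x) + c := fun x => by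
    simp only [V]
    rw [α.apply_add, α.apply_smul, hα.normalized, (hXh x).1, mul_one, add_zero]
  have hπV : ∀ x, mfderiv 𝓘(ℝ, E') 𝓘(ℝ, E) π x (V x) = A.generator (π x) := fun x => by
    simp only [V]
    rw [map_add, map_smul, hP.mfderiv_generator, smul_zero, zero_add, (hXh x).2]
  have hdαV : ∀ (x : M) (v : TangentSpace 𝓘(ℝ, E') x),
      α.d x ![V x, v] = -mvfderiv 𝓘(ℝ, E') (fun x => H (π x) + c) x v := fun x v => by
    rw [hM.d_apply, hπV, hA.hamiltonian, mvfderiv_comp_projection_add_const hP.mdifferentiable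
      (hA.smooth.mdifferentiable (by simp))]
  have hVloc : ∀ x, HasLocalFlowAt V x := hasLocalFlowAt_lift hP hα A
    (hA.smooth.add contMDiff_const) hαV hπV
  obtain ⟨F, hF, hF0, hFadd, hFV⟩ := exists_global_flow hVloc
  have hFt : ∀ t, ContMDiff 𝓘(ℝ, E') 𝓘(ℝ, E') ∞ (F t) := fun t =>
    hF.comp (contMDiff_const.prodMk contMDiff_id)
  -- Both sides are integral curves of X from the same point.
  have hπF : ∀ t x, π (F t x) = A.act (Circle.exp t) (π x) := by
    intro t x
    refine HasLocalFlowAt.integralCurve_unique A.hasLocalFlowAt_generator (γ := fun t => π (F t x))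
      (fun t => ?_) (A.isMIntegralCurve_orbit (π x)) (by simp [hF0, A.act_one]) t
    have h1 := (hP.mdifferentiable (F t x)).hasMFDerivAt.comp t (hFV x t)
    refine h1.congr_mfderiv ?_
    rw [← hπV]
    ext
    exact map_smul (mfderiv 𝓘(ℝ, E') 𝓘(ℝ, E) π (F t x)) (1 : ℝ) (V (F t x))
  have hFP : ∀ t g x, F t (P.act g x) = P.act g (F t x) := by
    intro t g x
    refine HasLocalFlowAt.integralCurve_unique hVloc (γ := fun t => F t (P.act g x))
      (γ' := fun t => P.act g (F t x)) (hFV _) (fun t => ?_) (by simp [hF0]) t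
    have h1 := ((P.contMDiff_act_right g).mdifferentiable (by simp) (F t x)).hasMFDerivAt.comp t
      (hFV x t)
    -- V is invariant under the principal action, since its projection and its α-value are.
    have h2 : mfderiv 𝓘(ℝ, E') 𝓘(ℝ, E') (P.act g) (F t x) (V (F t x)) = V (P.act g (F t x)) := by
      refine hα.tangent_ext hP ?_ ?_
      · rw [hP.mfderiv_act, hπV, hπV, hP.invariant]
      · rw [hα.apply_mfderiv_act, hαV, hαV, hP.invariant]
    refine h1.congr_mfderiv ?_
    rw [← h2]
    ext
    exact map_smul (mfderiv 𝓘(ℝ, E') 𝓘(ℝ, E') (P.act g) (F t x)) (1 : ℝ) (V (F t x))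
  have hFα : ∀ t x (v : TangentSpace 𝓘(ℝ, E') x),
      α (F t x) ![mfderiv 𝓘(ℝ, E') 𝓘(ℝ, E') (F t) x v] = α x ![v] :=
    hα.smooth.apply_mfderiv_flow ((hA.smooth.comp hP.smooth).add contMDiff_const) hαV hdαV
      hF hF0 hFV
  -- Over a zero of X the field V is vertical, and its coefficient is constant along the fibre.
  have hzero : ∀ x, A.generator (π x) = 0 →
      ∀ t, F t x = P.act (Circle.exp (t * (H (π x) + c))) x := by
    intro x hx t
    refine HasLocalFlowAt.integralCurve_unique hVloc
      (γ' := fun t => P.act (Circle.exp (t * (H (π x) + c))) x) (hFV x) (fun t => ?_)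
      (by simp [hF0, P.act_one]) t
    have h1 := (P.isMIntegralCurve_orbit x).comp_mul (H (π x) + c) t
    have h2 : V (P.act (Circle.exp (t * (H (π x) + c))) x) =
        (H (π x) + c) • P.generator (P.act (Circle.exp (t * (H (π x) + c))) x) := by
      refine hα.tangent_ext hP ?_ ?_
      · rw [hπV, map_smul, hP.mfderiv_generator, hP.invariant, hx, smul_zero]
      · rw [hαV, α.apply_smul, hα.normalized, mul_one, hP.invariant]
    rw [h2]
    exact h1
  have hT : ∀ x, F (2 * Real.pi) x = x := by
    obtain ⟨x₀, rfl⟩ := hP.surjective p₀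
    obtain ⟨m, hm⟩ := hc
    refine hα.gauge_eq_self hP (hFt _) (fun x => ?_) (hFα _) (fun g x => hFP _ g x) (x₀ := x₀) ?_
    · rw [hπF, Circle.exp_two_pi, A.act_one]
    · rw [hzero x₀ hp₀, hm, Circle.exp_two_pi_mul_int, P.act_one]
  refine ⟨fun p hp => ?_, ?_⟩
  · obtain ⟨x, rfl⟩ := hP.surjective p
    have h1 := hT x
    rw [hzero x hp] at h1
    -- The principal action is free, so a trivial rotation by 2π(H + c) has an integral number of
    -- turns.
    obtain ⟨n, hn⟩ := Circle.exp_eq_one.1 (hP.eq_one_of_act_eq_self h1)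
    refine ⟨n, mul_left_cancel₀ Real.two_pi_pos.ne' ?_⟩
    rw [hn, mul_comm]
  · obtain ⟨L, hL⟩ := exists_circleAction_of_periodic_flow hF hF0 hFadd hT
    have hLact : ∀ g, ∃ t, L.act g = F t ∧ Circle.exp t = g := fun g => by
      obtain ⟨t, rfl⟩ := Circle.exp_surjective g
      exact ⟨t, funext (hL t), rfl⟩
    have hgen : ∀ x, L.generator x = V x := by
      intro x
      have h1 : L.generator x = mfderiv 𝓘(ℝ, ℝ) 𝓘(ℝ, E') (fun t => F t x) 0 (1 : ℝ) :=
        congrArg (fun f : ℝ → M => (mfderiv 𝓘(ℝ, ℝ) 𝓘(ℝ, E') f 0 (1 : ℝ) : E'))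
          (funext fun t => hL t x)
      have h2 : mfderiv 𝓘(ℝ, ℝ) 𝓘(ℝ, E') (fun t => F t x) 0 (1 : ℝ) = (1 : ℝ) • V (F 0 x) :=
        congrArg (fun L => L (1 : ℝ)) (hFV x 0).mfderiv
      rw [h1, h2, one_smul, hF0]
    refine ⟨L, fun g x => ?_, fun g => ?_, hgen, fun x => ⟨?_, fun v => ?_⟩⟩
    · obtain ⟨t, hLt, rfl⟩ := hLact g
      rw [hLt, hπF]
    · obtain ⟨t, hLt, -⟩ := hLact g
      funext x
      ext v
      rw [hLt]
      have e : v = ![v 0] := by ext i; fin_cases i; rfl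
      rw [e]
      refine Eq.trans ?_ (hFα t x (v 0))
      refine congrArg (α (F t x) : (Fin 1 → E') → ℝ) (funext fun i => ?_)
      fin_cases i
      rfl
    · rw [hgen, hαV]
    -- The term dH̃(R) α drops out because R is vertical and H̃ is constant on fibres.
    · rw [hgen, hdαV, mvfderiv_comp_projection_add_const (v := P.generator x) hP.mdifferentiable
        (hA.smooth.mdifferentiable (by simp)), hP.mfderiv_generator, map_zero, zero_mul, zero_sub]

end Lift

end BoothbyWang

end

open BoothbyWang in
theorem mainTheorem3
    {E : Type*} [NormedAddCommGroup E] [NormedSpace ℝ E] [FiniteDimensional ℝ E]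
    {B : Type*} [TopologicalSpace B] [ChartedSpace E B] [IsManifold 𝓘(ℝ, E) ∞ B]
    [T2Space B] [CompactSpace B] [ConnectedSpace B]
    {E' : Type*} [NormedAddCommGroup E'] [NormedSpace ℝ E'] [FiniteDimensional ℝ E']
    {M : Type*} [TopologicalSpace M] [ChartedSpace E' M] [IsManifold 𝓘(ℝ, E') ∞ M] [T2Space M]
    (Ω : DiffForm E B 2) (hΩ : IsSymplectic Ω)
    (P : SmoothCircleAction E' M) (π : M → B) (α : DiffForm E' M 1)
    (hM : IsBoothbyWangBundle Ω P π α)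
    (A : SmoothCircleAction E B) (H : B → ℝ) (hA : IsHamiltonianAction Ω A H) :
    ∃ R Xh : ∀ x : M, TangentSpace 𝓘(ℝ, E') x,
      IsReebField α R ∧ IsHorizontalLift π α A.generator Xh ∧
      (∃ p₀ : B, A.generator p₀ = 0) ∧
      (∀ p₀ : B, A.generator p₀ = 0 →
        ∃ c : ℝ, (∀ b : B, 0 < H b + c) ∧ ∃ n : ℕ, H p₀ + c = n) ∧
      ∀ (p₀ : B) (c : ℝ), A.generator p₀ = 0 → (∃ m : ℤ, H p₀ + c = m) →
        (∀ p : B, A.generator p = 0 → ∃ m : ℤ, H p + c = m) ∧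
        ∃ L : SmoothCircleAction E' M,
          (∀ (g : Circle) (x : M), π (L.act g x) = A.act g (π x)) ∧
          (∀ g : Circle, α.pullback (L.act g) = α) ∧
          (∀ x : M, L.generator x = (H (π x) + c) • R x + Xh x) ∧
          IsContactHamiltonianField α R (fun x => H (π x) + c) L.generator := by
  obtain ⟨Xh, hXh⟩ := hM.connection.exists_horizontalLift hM.principal A.generator
  exact ⟨P.generator, Xh, hM.isReebField_generator, hXh, hA.exists_generator_eq_zero hΩ,
    fun p₀ _ => exists_add_const_pos_natCast hA.smooth.continuous p₀,
    fun p₀ c hp₀ hc => hM.exists_lift hA hXh hp₀ hc⟩
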